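/- A rooted plane multi-edge tree is a rooted plane (ordered) tree in which every vertex other than the root is joined to its parent by one or more parallel edges; it is counted according to its total number of edges (with multiplicity), and its height is the maximum distance of a vertex from the root. For $\alpha>0$ let $$G(\alpha)=\sum_{m\ge 1}(2\alpha^2m^2-3)\,m^2e^{-\alpha^2m^2}.$$ Let $0<\varepsilon<\frac16$. Then, for integers $n\ge 2$ and $h$ with $$\sqrt{\frac{4n\pi^2}{5\varepsilon\log n}}<h<n^{3/4-\varepsilon},$$ the probability that a uniformly random rooted plane multi-edge tree with $n$ edges has height $h$ is $$\frac{5h}{n}\,G\Bigl(\frac{\sqrt5\,h}{2\sqrt n}\Bigr)\Bigl(1+O\Bigl(\frac hn+\frac{h^4}{n^3}+\frac{\log n}{n^{1/2-2\varepsilon}}\Bigr)\Bigr),$$ where the implied constant depends only on $\varepsilon$ (it is uniform in $n$ and $h$). Moreover, for every $\alpha>0$, the series defining $G(\alpha)$ and the series below converge, and $$G(\alpha)=\frac{\sqrt{\pi^5}}{\alpha^5}\sum_{m\ge1}\Bigl(2\Bigl(\frac{\pi}{\alpha}\Bigr)^2m^2-3\Bigr)m^2\exp\Bigl(-\Bigl(\frac{\pi}{\alpha}\Bigr)^2m^2\Bigr).$$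 -/

import Mathlib

/-- Rooted plane multi-edge trees: a root with an ordered list of branches; the pair `(k, t)` is a
branch `t` whose root is joined to the parent vertex by `k ≥ 1` parallel edges. -/
inductive MultiEdgeTree : Type
  | node (branches : List (ℕ+ × MultiEdgeTree)) : MultiEdgeTree

namespace MultiEdgeTree

mutual

/-- The size of a multi-edge tree: its number of edges, counted with multiplicity. -/
def size : MultiEdgeTree → ℕ
  | node bs => branchesSize bs

/-- The number of edges of a list of branches, including the edges joining them to their parent. -/
def branchesSize : List (ℕ+ × MultiEdgeTree) → ℕ
  | [] => 0
  | (k, t) :: bs => ((k : ℕ) + size t) + branchesSize bs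

end

mutual

/-- The height of a multi-edge tree: the maximum distance of a vertex from the root. -/
def height : MultiEdgeTree → ℕ
  | node bs => branchesHeight bs

/-- The maximum distance from the parent to a vertex in one of the branches (`0` if there are
no branches). -/
def branchesHeight : List (ℕ+ × MultiEdgeTree) → ℕ
  | [] => 0
  | (_, t) :: bs => max (height t + 1) (branchesHeight bs)

end

/-- There are only finitely many multi-edge trees with at most `n` edges. -/
theorem finite_size_le (n : ℕ) : {T : MultiEdgeTree | T.size ≤ n}.Finite := by
  induction n with
  | zero =>
    refine (Set.finite_singleton (node [])).subset ?_
    rintro ⟨bs⟩ hT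
    match bs, hT with
    | [], _ => rfl
    | (k, t) :: cs, hT =>
      exfalso
      have hk := k.pos
      simp only [Set.mem_ofPred_eq, size, branchesSize] at hT
      omega
  | succ n ih =>
    have hK : {k : ℕ+ | (k : ℕ) ≤ n + 1}.Finite :=
      (Set.finite_le_nat (n + 1)).preimage PNat.coe_injective.injOn
    refine ((Set.finite_singleton (node [])).union
      ((hK.prod (ih.prod ih)).image
        (fun p : ℕ+ × MultiEdgeTree × MultiEdgeTree =>
          match p with
          | (k, t, node cs) => node ((k, t) :: cs)))).subset ?_
    rintro ⟨bs⟩ hT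
    match bs, hT with
    | [], _ => exact Or.inl rfl
    | (k, t) :: cs, hT =>
      right
      have hk := k.pos
      simp only [Set.mem_ofPred_eq, size, branchesSize] at hT
      refine ⟨(k, t, node cs), ⟨?_, ?_, ?_⟩, rfl⟩
      · simp only [Set.mem_ofPred_eq]; omega
      · simp only [Set.mem_ofPred_eq]; omega
      · simp only [Set.mem_ofPred_eq, size]; omega

/-- There are only finitely many multi-edge trees with `n` edges. -/
theorem finite_size_eq (n : ℕ) : {T : MultiEdgeTree | T.size = n}.Finite :=
  (finite_size_le n).subset fun _ hT => le_of_eq hT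

/-- There is a multi-edge tree with `n` edges. -/
theorem nonempty_size_eq (n : ℕ) : {T : MultiEdgeTree | T.size = n}.Nonempty := by
  cases n with
  | zero => exact ⟨node [], by simp [size, branchesSize]⟩
  | succ n =>
    exact ⟨node [(⟨n + 1, n.succ_pos⟩, node [])], by simp [size, branchesSize]⟩

/-- The probability that a uniformly random rooted plane multi-edge tree with `n` edges has
height `h`. The denominator is the cardinality of a finite nonempty set by `finite_size_eq` and
`nonempty_size_eq`. -/
noncomputable def heightProb (n h : ℕ) : ℝ :=
  ({T : MultiEdgeTree | T.size = n ∧ T.height = h}.ncard : ℝ) /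
    ({T : MultiEdgeTree | T.size = n}.ncard : ℝ)

/-- The function `G(α) = ∑_{m ≥ 1} (2 α² m² - 3) m² exp(-α² m²)`. -/
noncomputable def limitG (α : ℝ) : ℝ :=
  ∑' m : ℕ+, (2 * α ^ 2 * (m : ℝ) ^ 2 - 3) * (m : ℝ) ^ 2 * Real.exp (-α ^ 2 * (m : ℝ) ^ 2)

end MultiEdgeTree

/-!
Decomposing a tree at its first branch gives a recursion in `h` for the generating function `F_h` of
trees of height at most `h` (`heightSeries_succ`). Under the substitution `z = u / (1 + 3 u + u²)`
the recursion is solved by `(1 + u) (1 - u ^ (h + 1)) / (1 - u ^ (h + 2))`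
(`kernelSubst_heightSeries`), and Lagrange inversion (`coeff_eq_coeff_kernelSubst`) turns
coefficients in `z` into coefficients in `u`. Hence the number of trees with `n` edges and height
`h` is a sum over `m ≥ 1` of coefficients of
`(1 - u²)² (1 + 3 u + u²) ^ (n - 1) (u ^ (m (h + 1)) - u ^ (m (h + 2)))` (`ncard_eq_sum_coeff`).

Each coefficient is an integral over a circle `u = exp (i z)`, `z = θ + s i`, `-π ≤ θ ≤ π`, on which
the kernel `(3 + 2 cos z) / 5` is compared with the Gaussian `exp (-z² / 5)`. The two agree to third
order at the origin, and both are bounded by `exp (s² / 5 - c θ²)`, because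
`(3 + 2 cosh s) / 5 ≤ exp (s² / 5)`; so the difference of their powers is controlled without
logarithms. The radius `s = 5 m h / (2 n)` is the saddle point of the Gaussian integrand, so the
error carries the factor `exp (-α² m²)`, `α = √5 h / (2 √n)`, of the `m`-th term of `G α`, which is
the Gaussian integral itself (`integral_termGauss`, `exists_norm_coeff_termPoly_sub_le`). The number
of all trees is treated in the same way with `s = 0` (`exists_scaledTotal_eq`).

It remains to compare the sum of the errors with `G α`. For `α² ≥ 3` all terms of `G α` are positive
and the first one dominates. For `α² ≤ 3` this holds for the dual series, which comes from
differentiating the functional equation of the theta series twice (`limitG_dual`); it gives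
`G α ≥ α⁻⁷ exp (-π² / α²)`, and the lower bound on `h` says that `exp (π² / α²) ≤ n ^ ε`.
-/

namespace MultiEdgeTree

open Real

/-! ### The Gaussian power sums and the dual series of `G` -/

/-- The sum `∑_{m ≥ 1} m ^ (2 k) exp (-t m²)`; for `k = 0` this is half of the theta series
`∑_{m ∈ ℤ} exp (-t m²)` without its term at `0`. -/
noncomputable def gaussPowSum (k : ℕ) (t : ℝ) : ℝ :=
  ∑' m : ℕ+, (m : ℝ) ^ (2 * k) * exp (-t * (m : ℝ) ^ 2)

theorem summable_gaussPow (k : ℕ) {t : ℝ} (ht : 0 < t) :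
    Summable fun m : ℕ+ => (m : ℝ) ^ (2 * k) * exp (-t * (m : ℝ) ^ 2) := by
  have h1 : Summable fun m : ℕ+ => ((m : ℕ) : ℝ) ^ (2 * k) * exp (-t * ((m : ℕ) : ℝ)) :=
    (summable_pow_mul_exp_neg_nat_mul (2 * k) ht).comp_injective PNat.coe_injective
  refine h1.of_nonneg_of_le (fun m => by positivity) fun m => ?_
  have hm : (1 : ℝ) ≤ (m : ℝ) := Nat.one_le_cast.2 m.pos
  gcongr ?_ * exp ?_
  nlinarith [mul_le_mul_of_nonneg_left hm (mul_nonneg ht.le (zero_le_one.trans hm))]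

theorem hasDerivAt_gaussPowSum (k : ℕ) {t : ℝ} (ht : 0 < t) :
    HasDerivAt (gaussPowSum k) (-gaussPowSum (k + 1) t) t := by
  have h := hasDerivAt_tsum_of_isPreconnected (𝕜 := ℝ) (t := Set.Ioi (t / 2)) (y₀ := t) (y := t)
    (g := fun (m : ℕ+) (s : ℝ) => (m : ℝ) ^ (2 * k) * exp (-s * (m : ℝ) ^ 2))
    (g' := fun (m : ℕ+) (s : ℝ) => -((m : ℝ) ^ (2 * (k + 1)) * exp (-s * (m : ℝ) ^ 2)))
    (summable_gaussPow (k + 1) (half_pos ht)) isOpen_Ioi isPreconnected_Ioi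
    (fun m s _ => ?_) (fun m s hs => ?_) (half_lt_self ht) (summable_gaussPow k ht)
    (half_lt_self ht)
  · rw [tsum_neg] at h
    exact h
  · have := ((((hasDerivAt_id s).neg.mul_const ((m : ℝ) ^ 2)).exp).const_mul ((m : ℝ) ^ (2 * k)))
    refine this.congr_deriv ?_
    simp only [Pi.neg_apply, id]
    ring
  · have hs' : t / 2 < s := hs
    rw [norm_neg, norm_of_nonneg (by positivity)]
    gcongr

theorem theta_functional_equation {t : ℝ} (ht : 0 < t) :
    √t * (1 + 2 * gaussPowSum 0 t) = √π * (1 + 2 * gaussPowSum 0 (π ^ 2 / t)) := by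
  have key : ∀ s : ℝ, 0 < s → ∑' n : ℤ, exp (-s * (n : ℝ) ^ 2) = 1 + 2 * gaussPowSum 0 s := by
    intro s hs
    have hsum : Summable fun n : ℤ => exp (-s * (n : ℝ) ^ 2) := by
      have h0 : Summable fun n : ℕ => exp (-s * (n : ℝ) ^ 2) := by
        rw [← summable_pnat_iff_summable_nat]
        simpa using summable_gaussPow 0 hs
      refine Summable.of_nat_of_neg (by simpa using h0) (by simpa using h0)
    rw [tsum_int_eq_zero_add_two_mul_tsum_pnat (fun n => by simp) hsum]
    simp [gaussPowSum]
  have h := Real.tsum_exp_neg_mul_int_sq (div_pos ht pi_pos)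
  have e1 : -π * (t / π) = -t := by field_simp
  have e2 : -π / (t / π) = -(π ^ 2 / t) := by field_simp
  simp_rw [e1, e2] at h
  rw [key _ ht, key _ (by positivity), ← sqrt_eq_rpow, sqrt_div ht.le] at h
  rw [h]
  have : 0 < √t := sqrt_pos.2 ht
  field_simp

theorem limitG_eq_gaussPowSum {α : ℝ} (hα : 0 < α) :
    limitG α = 2 * α ^ 2 * gaussPowSum 2 (α ^ 2) - 3 * gaussPowSum 1 (α ^ 2) := by
  have ht : 0 < α ^ 2 := by positivity
  unfold limitG gaussPowSum
  rw [← tsum_mul_left, ← tsum_mul_left, ← ((summable_gaussPow 2 ht).mul_left _).tsum_sub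
    ((summable_gaussPow 1 ht).mul_left _)]
  congr 1
  ext m
  ring

theorem summable_limitG {α : ℝ} (hα : 0 < α) :
    Summable fun m : ℕ+ =>
      (2 * α ^ 2 * (m : ℝ) ^ 2 - 3) * (m : ℝ) ^ 2 * exp (-α ^ 2 * (m : ℝ) ^ 2) := by
  have ht : 0 < α ^ 2 := by positivity
  refine (((summable_gaussPow 2 ht).mul_left (2 * α ^ 2)).sub
    ((summable_gaussPow 1 ht).mul_left 3)).congr fun m => ?_
  ring

/-- First derivative of the theta functional equation, multiplied by `√t`. -/
theorem theta_functional_equation_deriv {t : ℝ} (ht : 0 < t) :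
    (1 + 2 * gaussPowSum 0 t) / 2 - 2 * t * gaussPowSum 1 t =
      2 * √π * π ^ 2 * (√t * (t ^ 2)⁻¹ * gaussPowSum 1 (π ^ 2 / t)) := by
  have hs : 0 < √t := sqrt_pos.2 ht
  have hinv : HasDerivAt (fun s : ℝ => π ^ 2 / s) (-(π ^ 2) / t ^ 2) t := by
    simpa [div_eq_mul_inv] using (hasDerivAt_inv ht.ne').const_mul (π ^ 2)
  have h1 := (hasDerivAt_sqrt ht.ne').mul (((hasDerivAt_gaussPowSum 0 ht).const_mul 2).const_add 1)
  have h2 := ((((hasDerivAt_gaussPowSum 0 (t := π ^ 2 / t) (by positivity)).comp t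
    hinv).const_mul 2).const_add 1).const_mul √π
  have h3 := h1.unique (h2.congr_of_eventuallyEq ((eventually_gt_nhds ht).mono fun s hs =>
    theta_functional_equation hs))
  have h4 := congrArg (fun x => x * √t) h3
  simp only [zero_add] at h4
  have hsq : √t * √t = t := mul_self_sqrt ht.le
  calc _ = (1 / (2 * √t) * (1 + 2 * gaussPowSum 0 t) + √t * (2 * -gaussPowSum 1 t)) * √t := by
        field_simp
        linear_combination (4 * gaussPowSum 1 t) * hsq
    _ = _ := h4
    _ = _ := by ring

theorem limitG_dual_gaussPowSum {t : ℝ} (ht : 0 < t) :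
    2 * t * gaussPowSum 2 t - 3 * gaussPowSum 1 t = √π * π ^ 2 * (√t * (t ^ 3)⁻¹) *
      (2 * (π ^ 2 / t) * gaussPowSum 2 (π ^ 2 / t) - 3 * gaussPowSum 1 (π ^ 2 / t)) := by
  have hs : 0 < √t := sqrt_pos.2 ht
  have hinv : HasDerivAt (fun s : ℝ => π ^ 2 / s) (-(π ^ 2) / t ^ 2) t := by
    simpa [div_eq_mul_inv] using (hasDerivAt_inv ht.ne').const_mul (π ^ 2)
  have h1 := ((((hasDerivAt_gaussPowSum 0 ht).const_mul 2).const_add 1).div_const 2).sub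
    (((hasDerivAt_id t).const_mul 2).mul (hasDerivAt_gaussPowSum 1 ht))
  have h2 := (((hasDerivAt_sqrt ht.ne').mul ((hasDerivAt_pow 2 t).inv (by positivity))).mul
    ((hasDerivAt_gaussPowSum 1 (t := π ^ 2 / t) (by positivity)).comp t hinv)).const_mul
    (2 * √π * π ^ 2)
  have h3 := h1.unique (h2.congr_of_eventuallyEq ((eventually_gt_nhds ht).mono fun s hs =>
    theta_functional_equation_deriv hs))
  have hsq : √t ^ 2 = t := sq_sqrt ht.le
  simp only [Pi.mul_apply, Function.comp, zero_add, id, Pi.inv_apply, Nat.cast_ofNat,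
    Nat.reduceAdd, Nat.reduceSub, pow_one] at h3
  calc _ = 2 * -gaussPowSum 1 t / 2 - (2 * 1 * gaussPowSum 1 t + 2 * t * -gaussPowSum 2 t) := by
        ring
    _ = _ := h3
    _ = _ := by
        have h5 : 1 / (2 * √t) = √t / (2 * t) := by
          field_simp
          exact hsq.symm
        rw [h5]
        field_simp
        ring

theorem limitG_dual {α : ℝ} (hα : 0 < α) :
    limitG α = √(π ^ 5) / α ^ 5 * limitG (π / α) := by
  have h := limitG_dual_gaussPowSum (t := α ^ 2) (by positivity)
  rw [limitG_eq_gaussPowSum hα, limitG_eq_gaussPowSum (div_pos pi_pos hα), h, sqrt_sq hα.le,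
    div_pow]
  have h5 : √(π ^ 5) = √π * π ^ 2 := by
    rw [show π ^ 5 = (π ^ 2) ^ 2 * π by ring, sqrt_mul (by positivity), sqrt_sq (by positivity)]
    ring
  rw [h5]
  field_simp

/-! ### Lower bounds for `G` -/

theorem le_limitG_of_three_le {α : ℝ} (hα : 0 < α) (h3 : 3 ≤ α ^ 2) :
    α ^ 2 * exp (-α ^ 2) ≤ limitG α := by
  have h := (summable_limitG hα).le_tsum 1 fun m _ => by
    have hm : (1 : ℝ) ≤ (m : ℝ) ^ 2 := one_le_pow₀ (Nat.one_le_cast.2 m.pos)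
    have : 0 ≤ 2 * α ^ 2 * (m : ℝ) ^ 2 - 3 := by nlinarith
    positivity
  refine le_trans ?_ h
  simp only [PNat.one_coe, Nat.cast_one, one_pow, mul_one]
  gcongr
  linarith

/-- Lower bound by the first term of the dual series, all of whose terms are positive as `3 ≤ (π /
α)²`. -/
theorem le_limitG_of_le_three {α : ℝ} (hα : 0 < α) (h3 : α ^ 2 ≤ 3) :
    exp (-(π ^ 2 / α ^ 2)) / α ^ 7 ≤ limitG α := by
  have hpi : 3 < π := pi_gt_three
  have h9 : 3 ≤ (π / α) ^ 2 := by
    rw [div_pow, le_div_iff₀ (by positivity)]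
    nlinarith
  have h := le_limitG_of_three_le (div_pos pi_pos hα) h9
  rw [limitG_dual hα]
  have h1 : 1 ≤ √(π ^ 5) := by
    rw [one_le_sqrt]
    exact one_le_pow₀ (by linarith)
  have h2 : 1 ≤ π ^ 2 := one_le_pow₀ (by linarith)
  have h0 : (0 : ℝ) ≤ limitG (π / α) := le_trans (by positivity) h
  calc exp (-(π ^ 2 / α ^ 2)) / α ^ 7 = 1 / α ^ 5 * (1 / α ^ 2 * exp (-(π / α) ^ 2)) := by
        rw [div_pow]
        field_simp
    _ ≤ √(π ^ 5) / α ^ 5 * ((π / α) ^ 2 * exp (-(π / α) ^ 2)) := by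
        rw [div_pow π]
        gcongr
    _ ≤ _ := by gcongr

theorem limitG_pos {α : ℝ} (hα : 0 < α) : 0 < limitG α := by
  rcases le_total (α ^ 2) 3 with h | h
  · exact lt_of_lt_of_le (by positivity) (le_limitG_of_le_three hα h)
  · exact lt_of_lt_of_le (by positivity) (le_limitG_of_three_le hα h)

/-! ### Sums of the error terms -/

theorem exists_one_add_pow_mul_exp_neg_sq_le (k : ℕ) {c : ℝ} (hc : 0 < c) :
    ∃ C : ℝ, 0 < C ∧ ∀ x : ℝ, 0 ≤ x → (1 + x) ^ k * exp (-c * x ^ 2) ≤ C := by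
  refine ⟨k.factorial * exp (1 + 1 / (4 * c)), by positivity, fun x hx => ?_⟩
  have h1 := pow_div_factorial_le_exp (1 + x) (by linarith) k
  rw [div_le_iff₀ (by positivity)] at h1
  have h2 : 1 + x + -c * x ^ 2 ≤ 1 + 1 / (4 * c) := by
    have : 1 / (4 * c) - x + c * x ^ 2 = c * (x - 1 / (2 * c)) ^ 2 := by
      field_simp
      ring
    nlinarith [mul_nonneg hc.le (sq_nonneg (x - 1 / (2 * c)))]
  calc (1 + x) ^ k * exp (-c * x ^ 2) ≤ (exp (1 + x) * k.factorial) * exp (-c * x ^ 2) := by gcongr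
    _ = k.factorial * exp (1 + x + -c * x ^ 2) := by rw [exp_add (1 + x)]; ring
    _ ≤ _ := by gcongr

/-- The size, up to a constant and relative to the leading scale, of the error made in replacing
the `m`-th term of the exact count by the `m`-th term of `G`. -/
noncomputable def termError (n : ℕ) (α : ℝ) (m : ℕ+) : ℝ :=
  1 / α * exp (-α ^ 2 * (m : ℝ) ^ 2) *
    ((m : ℝ) * (1 + √5 * α * m) ^ 7 / n + (m : ℝ) ^ 2 * (1 + √5 * α * m) ^ 4 / √n)

theorem termError_nonneg (n : ℕ) {α : ℝ} (hα : 0 < α) (m : ℕ+) : 0 ≤ termError n α m := by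
  unfold termError
  positivity

theorem summable_one_div_pnat_sq : Summable fun m : ℕ+ => 1 / (m : ℝ) ^ 2 := by
  have := (Real.summable_one_div_nat_pow (p := 2)).2 one_lt_two
  exact this.comp_injective PNat.coe_injective

theorem sqrt_five_le : √5 ≤ 3 := by
  rw [sqrt_le_left (by norm_num)]
  norm_num

theorem exists_tsum_termError_le_small : ∃ C : ℝ, 0 < C ∧ ∀ (n : ℕ) (α : ℝ), 1 ≤ n → 0 < α →
    Summable (termError n α) ∧ ∑' m, termError n α m ≤ C / (α ^ 5 * √n) := by
  obtain ⟨C, hC, hCb⟩ := exists_one_add_pow_mul_exp_neg_sq_le 11 one_pos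
  have hZ : 0 < ∑' m : ℕ+, 1 / (m : ℝ) ^ 2 :=
    summable_one_div_pnat_sq.tsum_pos (fun m => by positivity) 1 (by simp)
  refine ⟨2 * 3 ^ 7 * C * ∑' m : ℕ+, 1 / (m : ℝ) ^ 2, by positivity, fun n α hn hα => ?_⟩
  have hn' : (1 : ℝ) ≤ n := by exact_mod_cast hn
  have hn0 : 1 ≤ √(n : ℝ) := by rwa [one_le_sqrt]
  have hle : ∀ m, termError n α m ≤ 2 * 3 ^ 7 * C / (α ^ 5 * √n) * (1 / (m : ℝ) ^ 2) := by
    intro m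
    have hm : (1 : ℝ) ≤ (m : ℝ) := Nat.one_le_cast.2 m.pos
    set y : ℝ := √5 * α * m with hy
    have hy0 : 0 ≤ y := by positivity
    set x : ℝ := α * m with hx
    have hx0 : 0 < x := by positivity
    have hyx : 1 + y ≤ 3 * (1 + x) := by
      have : y ≤ 3 * x := by
        rw [hy, mul_assoc]
        exact mul_le_mul_of_nonneg_right sqrt_five_le hx0.le
      linarith
    have hb := hCb x hx0.le
    have e1 : (m : ℝ) * (1 + y) ^ 7 / n ≤ (m : ℝ) ^ 2 * (1 + y) ^ 7 / √n := by
      have : √(n : ℝ) ≤ n := by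
        rw [sqrt_le_left (by linarith)]
        nlinarith
      gcongr
      nlinarith
    have e2 : (m : ℝ) ^ 2 * (1 + y) ^ 4 / √n ≤ (m : ℝ) ^ 2 * (1 + y) ^ 7 / √n := by
      gcongr
      · linarith
      · norm_num
    have e3 : x ^ 4 * (1 + y) ^ 7 * exp (-1 * x ^ 2) ≤ 3 ^ 7 * C := by
      calc x ^ 4 * (1 + y) ^ 7 * exp (-1 * x ^ 2)
          ≤ (1 + x) ^ 4 * (3 * (1 + x)) ^ 7 * exp (-1 * x ^ 2) := by
            gcongr
            linarith
        _ = 3 ^ 7 * ((1 + x) ^ 11 * exp (-1 * x ^ 2)) := by ring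
        _ ≤ _ := by gcongr
    have e4 : -α ^ 2 * (m : ℝ) ^ 2 = -1 * x ^ 2 := by rw [hx]; ring
    calc termError n α m
        = 1 / α * exp (-1 * x ^ 2) * ((m : ℝ) * (1 + y) ^ 7 / n
            + (m : ℝ) ^ 2 * (1 + y) ^ 4 / √n) := by rw [termError, e4]
      _ ≤ 1 / α * exp (-1 * x ^ 2) * ((m : ℝ) ^ 2 * (1 + y) ^ 7 / √n
            + (m : ℝ) ^ 2 * (1 + y) ^ 7 / √n) := by gcongr
      _ = 2 / (α ^ 5 * √n) * (1 / (m : ℝ) ^ 2) * (x ^ 4 * (1 + y) ^ 7 * exp (-1 * x ^ 2)) := by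
          rw [hx]
          field_simp
          ring
      _ ≤ 2 / (α ^ 5 * √n) * (1 / (m : ℝ) ^ 2) * (3 ^ 7 * C) := by gcongr
      _ = _ := by ring
  have hs : Summable (termError n α) :=
    (summable_one_div_pnat_sq.mul_left _).of_nonneg_of_le (termError_nonneg n hα) hle
  refine ⟨hs, (hs.tsum_le_tsum hle (summable_one_div_pnat_sq.mul_left _)).trans_eq ?_⟩
  rw [tsum_mul_left]
  ring

/-- For `α ≥ 1` the error of the first term dominates. -/
theorem exists_tsum_termError_le_large : ∃ C : ℝ, 0 < C ∧ ∀ (n : ℕ) (α : ℝ), 1 ≤ n → 1 ≤ α →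
    ∑' m, termError n α m ≤ C * exp (-α ^ 2) * (α ^ 6 / n + α ^ 3 / √n) := by
  obtain ⟨C, hC, hCb⟩ := exists_one_add_pow_mul_exp_neg_sq_le 10 one_pos
  obtain ⟨C', hC', hCb'⟩ := exists_tsum_termError_le_small
  have hZ : 0 < ∑' m : ℕ+, 1 / (m : ℝ) ^ 2 :=
    summable_one_div_pnat_sq.tsum_pos (fun m => by positivity) 1 (by simp)
  refine ⟨4 ^ 7 * (C * exp 1) * ∑' m : ℕ+, 1 / (m : ℝ) ^ 2, by positivity, fun n α hn hα => ?_⟩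
  have hα0 : 0 < α := by linarith
  have hn' : (1 : ℝ) ≤ n := by exact_mod_cast hn
  have hn0 : 1 ≤ √(n : ℝ) := by rwa [one_le_sqrt]
  have hle : ∀ m, termError n α m ≤ 4 ^ 7 * (C * exp 1) * exp (-α ^ 2) * (α ^ 6 / n + α ^ 3 / √n)
      * (1 / (m : ℝ) ^ 2) := by
    intro m
    have hm : (1 : ℝ) ≤ (m : ℝ) := Nat.one_le_cast.2 m.pos
    have hy : 1 + √5 * α * m ≤ 4 * (α * m) := by
      have h1 : 1 ≤ α * m := by nlinarith
      have h2 := mul_le_mul_of_nonneg_right sqrt_five_le (zero_le_one.trans h1)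
      linarith
    have he : exp (-α ^ 2 * (m : ℝ) ^ 2) ≤ exp (-α ^ 2) * (exp 1 * exp (-1 * (m : ℝ) ^ 2)) := by
      rw [← exp_add, ← exp_add, exp_le_exp]
      have h1 : 1 ≤ (m : ℝ) ^ 2 := one_le_pow₀ hm
      have h2 : 1 ≤ α ^ 2 := one_le_pow₀ hα
      nlinarith
    have hb := hCb m (by positivity)
    have hb2 : (m : ℝ) ^ 10 * exp (-1 * (m : ℝ) ^ 2) ≤ C :=
      le_trans (by gcongr; linarith) hb
    calc termError n α m
        ≤ 1 / α * (exp (-α ^ 2) * (exp 1 * exp (-1 * (m : ℝ) ^ 2))) *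
          ((m : ℝ) * (4 * (α * m)) ^ 7 / n + (m : ℝ) ^ 2 * (4 * (α * m)) ^ 4 / √n) := by
          unfold termError
          gcongr
      _ = exp (-α ^ 2) * (exp 1 * exp (-1 * (m : ℝ) ^ 2)) *
          (4 ^ 7 * α ^ 6 * (m : ℝ) ^ 8 / n + 4 ^ 4 * α ^ 3 * (m : ℝ) ^ 6 / √n) := by
          field_simp
      _ ≤ exp (-α ^ 2) * (exp 1 * exp (-1 * (m : ℝ) ^ 2)) *
          (4 ^ 7 * α ^ 6 * (m : ℝ) ^ 8 / n + 4 ^ 7 * α ^ 3 * (m : ℝ) ^ 8 / √n) := by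
          have h6 : (m : ℝ) ^ 6 ≤ (m : ℝ) ^ 8 := pow_le_pow_right₀ hm (by norm_num)
          gcongr
          · norm_num
          · norm_num
      _ = 4 ^ 7 * exp 1 * exp (-α ^ 2) * (α ^ 6 / n + α ^ 3 / √n) * (1 / (m : ℝ) ^ 2) *
          ((m : ℝ) ^ 10 * exp (-1 * (m : ℝ) ^ 2)) := by
          field_simp
      _ ≤ 4 ^ 7 * exp 1 * exp (-α ^ 2) * (α ^ 6 / n + α ^ 3 / √n) * (1 / (m : ℝ) ^ 2) * C := by
          gcongr
      _ = _ := by ring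
  refine (((hCb' n α hn hα0).1).tsum_le_tsum hle
    (summable_one_div_pnat_sq.mul_left _)).trans_eq ?_
  rw [tsum_mul_left]
  ring

end MultiEdgeTree

namespace MultiEdgeTree

/-! ### Counting trees of bounded height -/

/-- The number of multi-edge trees with `n` edges and height at most `h`. -/
noncomputable def countLE (h n : ℕ) : ℕ := {T : MultiEdgeTree | T.size = n ∧ T.height ≤ h}.ncard

theorem finite_size_eq_height_le (h n : ℕ) :
    {T : MultiEdgeTree | T.size = n ∧ T.height ≤ h}.Finite :=
  (finite_size_eq n).subset fun _ hT => hT.1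

theorem size_eq_zero_iff {T : MultiEdgeTree} : T.size = 0 ↔ T = node [] := by
  rcases T with ⟨bs⟩
  match bs with
  | [] => simp [size, branchesSize]
  | (k, t) :: cs =>
    have hk := k.pos
    simp only [size, branchesSize, node.injEq, reduceCtorEq, iff_false]
    omega

theorem height_eq_zero_iff {T : MultiEdgeTree} : T.height = 0 ↔ T = node [] := by
  rcases T with ⟨bs⟩
  match bs with
  | [] => simp [height, branchesHeight]
  | (k, t) :: cs =>
    simp only [height, branchesHeight, node.injEq, reduceCtorEq, iff_false]
    omega

theorem countLE_size_zero (h : ℕ) : countLE h 0 = 1 := by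
  rw [countLE, Set.ncard_eq_one]
  refine ⟨node [], Set.ext fun T => ?_⟩
  simp only [Set.mem_ofPred_eq, Set.mem_singleton_iff, size_eq_zero_iff]
  refine ⟨fun hT => hT.1, fun hT => ⟨hT, ?_⟩⟩
  simp [height_eq_zero_iff.2 hT]

theorem countLE_height_zero (n : ℕ) : countLE 0 (n + 1) = 0 := by
  rw [countLE, Set.ncard_eq_zero (finite_size_eq_height_le 0 (n + 1)),
    Set.eq_empty_iff_forall_notMem]
  rintro T ⟨h1, h2⟩
  have := size_eq_zero_iff.2 (height_eq_zero_iff.1 (Nat.le_zero.1 h2))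
  omega

/-- The root of the second tree receives the first tree as its new first branch, attached by a
single edge. -/
def graft : MultiEdgeTree × MultiEdgeTree → MultiEdgeTree
  | (t, node cs) => node ((1, t) :: cs)

/-- The multiplicity of the edge to the first branch is increased by one; a tree without branches is
left unchanged. -/
def thicken : MultiEdgeTree → MultiEdgeTree
  | node [] => node []
  | node ((k, t) :: cs) => node ((k + 1, t) :: cs)

theorem graft_injective : Function.Injective graft := by
  rintro ⟨t, ⟨cs⟩⟩ ⟨t', ⟨cs'⟩⟩ h
  simpa [graft] using h

theorem thicken_injective : Function.Injective thicken := by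
  rintro ⟨cs⟩ ⟨cs'⟩ h
  match cs, cs', h with
  | [], [], _ => rfl
  | (k, t) :: cs, (k', t') :: cs', h => simpa [thicken] using h

/-- The edge to the first branch is either simple, and then the tree is a graft, or multiple, and
then the tree is obtained by thickening. -/
theorem setOf_size_succ_eq (h n : ℕ) :
    {T : MultiEdgeTree | T.size = n + 1 ∧ T.height ≤ h + 1} =
      graft '' {p | (p.1.height ≤ h ∧ p.2.height ≤ h + 1) ∧ p.1.size + p.2.size = n} ∪
      thicken '' ({T | T.size = n ∧ T.height ≤ h + 1} \ {node []}) := by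
  ext T
  constructor
  · rintro ⟨h1, h2⟩
    rcases T with ⟨bs⟩
    match bs, h1, h2 with
    | [], h1, _ => simp [size, branchesSize] at h1
    | (k, t) :: cs, h1, h2 =>
      simp only [size, branchesSize, height, branchesHeight] at h1 h2
      by_cases hk : k = 1
      · subst hk
        refine Or.inl ⟨(t, node cs), ⟨⟨?_, ?_⟩, ?_⟩, rfl⟩ <;>
          simp only [size, height, PNat.one_coe] at * <;> omega
      · obtain ⟨j, rfl⟩ := PNat.exists_eq_succ_of_ne_one hk
        refine Or.inr ⟨node ((j, t) :: cs), ⟨⟨?_, ?_⟩, by simp⟩, rfl⟩ <;>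
          simp only [size, branchesSize, height, branchesHeight, PNat.add_coe,
            PNat.one_coe] at * <;>
          omega
  · rintro (⟨⟨t, ⟨cs⟩⟩, ⟨⟨h1, h2⟩, h3⟩, rfl⟩ | ⟨⟨cs⟩, ⟨⟨h1, h2⟩, h3⟩, rfl⟩)
    · simp only [graft, Set.mem_ofPred_eq, size, branchesSize, height, branchesHeight,
        PNat.one_coe] at *
      omega
    · match cs, h1, h2, h3 with
      | [], _, _, h3 => simp at h3
      | (k, t) :: cs, h1, h2, h3 =>
        simp only [thicken, Set.mem_ofPred_eq, size, branchesSize, height, branchesHeight,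
          PNat.add_coe, PNat.one_coe] at *
        omega

theorem ncard_pairs (h n : ℕ) :
    {p : MultiEdgeTree × MultiEdgeTree |
      (p.1.height ≤ h ∧ p.2.height ≤ h + 1) ∧ p.1.size + p.2.size = n}.ncard =
      ∑ p ∈ Finset.HasAntidiagonal.antidiagonal n, countLE h p.1 * countLE (h + 1) p.2 := by
  classical
  have hfin : {p : MultiEdgeTree × MultiEdgeTree |
      (p.1.height ≤ h ∧ p.2.height ≤ h + 1) ∧ p.1.size + p.2.size = n}.Finite := by
    refine ((finite_size_le n).prod (finite_size_le n)).subset fun p hp => ⟨?_, ?_⟩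
    · have := hp.2
      simp only [Set.mem_ofPred_eq]
      omega
    · have := hp.2
      simp only [Set.mem_ofPred_eq]
      omega
  rw [Set.ncard_eq_toFinset_card _ hfin, Finset.card_eq_sum_card_fiberwise
    (f := fun p : MultiEdgeTree × MultiEdgeTree => (p.1.size, p.2.size))
    (t := Finset.HasAntidiagonal.antidiagonal n)
    (fun p hp => by simpa using (hfin.mem_toFinset.1 hp).2)]
  refine Finset.sum_congr rfl fun q hq => ?_
  rw [countLE, countLE, ← Set.ncard_prod, ← Set.ncard_coe_finset]
  congr 1
  ext ⟨t, c⟩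
  have hq' := Finset.HasAntidiagonal.mem_antidiagonal.1 hq
  simp only [Finset.coe_filter, Set.Finite.mem_toFinset, Set.mem_ofPred_eq, Set.mem_prod,
    Prod.ext_iff]
  constructor
  · rintro ⟨⟨⟨h1, h2⟩, _⟩, h3, h4⟩
    exact ⟨⟨h3, h1⟩, h4, h2⟩
  · rintro ⟨⟨h3, h1⟩, h4, h2⟩
    exact ⟨⟨⟨h1, h2⟩, by omega⟩, h3, h4⟩

theorem countLE_succ_succ (h n : ℕ) :
    countLE (h + 1) (n + 1) + (if n = 0 then 1 else 0) =
      ∑ p ∈ Finset.HasAntidiagonal.antidiagonal n, countLE h p.1 * countLE (h + 1) p.2 +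
        countLE (h + 1) n := by
  have hfin := finite_size_eq_height_le (h + 1) (n + 1)
  have hdiff : ({T : MultiEdgeTree | T.size = n ∧ T.height ≤ h + 1} \ {node []}).ncard +
      (if n = 0 then 1 else 0) = countLE (h + 1) n := by
    by_cases hn : n = 0
    · rw [if_pos hn, countLE]
      refine Set.ncard_sdiff_singleton_add_one ?_ (finite_size_eq_height_le (h + 1) n)
      exact ⟨by rw [hn]; exact size_eq_zero_iff.2 rfl, by simp [height_eq_zero_iff.2 rfl]⟩
    · rw [if_neg hn, countLE, add_zero, Set.sdiff_singleton_eq_self]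
      rintro ⟨h1, _⟩
      exact hn (h1.symm.trans (size_eq_zero_iff.2 rfl))
  rw [← hdiff, ← ncard_pairs, countLE, ← add_assoc, setOf_size_succ_eq, Set.ncard_union_eq ?_
    (hfin.subset (setOf_size_succ_eq h n ▸ Set.subset_union_left))
    (hfin.subset (setOf_size_succ_eq h n ▸ Set.subset_union_right)),
    Set.ncard_image_of_injective _ graft_injective,
    Set.ncard_image_of_injective _ thicken_injective]
  · rw [Set.disjoint_left]
    rintro _ ⟨⟨t, ⟨cs⟩⟩, _, rfl⟩ ⟨⟨ds⟩, ⟨_, hd⟩, h2⟩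
    match ds, hd, h2 with
    | [], hd, _ => simp at hd
    | (k, t') :: ds, _, h2 =>
      simp only [thicken, graft, node.injEq, List.cons.injEq, Prod.mk.injEq] at h2
      have h3 := congrArg PNat.val h2.1.1
      have h4 := k.pos
      simp only [PNat.add_coe, PNat.one_coe] at h3
      omega

theorem ncard_height_eq (h n : ℕ) :
    {T : MultiEdgeTree | T.size = n ∧ T.height = h + 1}.ncard + countLE h n =
      countLE (h + 1) n := by
  rw [countLE, countLE, ← Set.ncard_union_eq ?_ ((finite_size_eq n).subset fun _ hT => hT.1)
    (finite_size_eq_height_le h n)]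
  · congr 1
    ext T
    simp only [Set.mem_union, Set.mem_ofPred_eq]
    omega
  · rw [Set.disjoint_left]
    rintro T ⟨_, h1⟩ ⟨_, h2⟩
    omega

mutual

theorem height_le_size : ∀ T : MultiEdgeTree, T.height ≤ T.size
  | node bs => by
    simp only [height, size]
    exact branchesHeight_le_branchesSize bs

theorem branchesHeight_le_branchesSize :
    ∀ bs : List (ℕ+ × MultiEdgeTree), branchesHeight bs ≤ branchesSize bs
  | [] => by simp [branchesHeight]
  | (k, t) :: bs => by
    have h1 := height_le_size t
    have h2 := branchesHeight_le_branchesSize bs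
    have h3 := k.pos
    simp only [branchesHeight, branchesSize]
    omega

end

theorem ncard_size_eq (n : ℕ) : {T : MultiEdgeTree | T.size = n}.ncard = countLE n n := by
  rw [countLE]
  congr 1
  ext T
  have := height_le_size T
  simp only [Set.mem_ofPred_eq]
  omega

end MultiEdgeTree

namespace MultiEdgeTree

open PowerSeries

/-! ### The generating function and its coefficients -/

/-- The generating function of multi-edge trees of height at most `h`, by number of edges. -/
noncomputable def heightSeries (h : ℕ) : ℂ⟦X⟧ := PowerSeries.mk fun n => (countLE h n : ℂ)

theorem heightSeries_zero : heightSeries 0 = 1 := by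
  ext n
  rcases n with _ | n
  · simp [heightSeries, countLE_size_zero]
  · simp [heightSeries, countLE_height_zero, coeff_one]

/-- The decomposition at the first branch, as an equation for generating functions. -/
theorem heightSeries_succ (h : ℕ) :
    (1 - X) * heightSeries (h + 1) = (1 - X) + X * (heightSeries h * heightSeries (h + 1)) := by
  ext n
  rcases n with _ | n
  · simp [heightSeries, countLE_size_zero]
  · have key := congrArg (Nat.cast : ℕ → ℂ) (countLE_succ_succ h n)
    push_cast at key
    rw [sub_mul, one_mul, map_sub, map_add, map_sub, coeff_succ_X_mul, coeff_succ_X_mul, coeff_mul,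
      coeff_one, coeff_X]
    simp only [heightSeries, coeff_mk, Nat.add_eq_zero_iff, one_ne_zero, and_false, if_false,
      Nat.add_eq_right] at key ⊢
    linear_combination key

/-- The polynomial `1 + 3 u + u²`; the substitution `z = u / (1 + 3 u + u²)` makes the generating
functions of trees of bounded height rational in `u` with explicit numerator and denominator. -/
noncomputable def kernelPoly : Polynomial ℂ := 1 + 3 * Polynomial.X + Polynomial.X ^ 2

/-- `kernelPoly` as a power series. -/
noncomputable def kernelSeries : ℂ⟦X⟧ := (kernelPoly : ℂ⟦X⟧)

theorem kernelSeries_eq : kernelSeries = 1 + 3 * X + X ^ 2 := by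
  simp only [kernelSeries, kernelPoly, Polynomial.coe_add, Polynomial.coe_mul, Polynomial.coe_pow,
    Polynomial.coe_X, Polynomial.coe_one]
  congr 3
  exact Polynomial.coe_C (3 : ℂ)

theorem kernelSeries_mul_inv : kernelSeries * kernelSeries⁻¹ = 1 := by
  refine PowerSeries.mul_inv_cancel _ ?_
  simp [kernelSeries_eq]

theorem hasSubst_X_mul_inv : HasSubst (X * kernelSeries⁻¹ : ℂ⟦X⟧) :=
  HasSubst.of_constantCoeff_zero' (by simp)

/-- The substitution `z = u / (1 + 3 u + u²)` on formal power series. -/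
noncomputable def kernelSubst : ℂ⟦X⟧ →ₐ[ℂ] ℂ⟦X⟧ := substAlgHom hasSubst_X_mul_inv

theorem kernelSubst_X : kernelSubst X = X * kernelSeries⁻¹ := substAlgHom_X hasSubst_X_mul_inv

/-- Closed form of the generating function after the substitution `z = u / (1 + 3 u + u²)`. -/
theorem kernelSubst_heightSeries (h : ℕ) :
    kernelSubst (heightSeries h) * (1 - X ^ (h + 2)) = (1 + X) * (1 - X ^ (h + 1)) := by
  induction h with
  | zero =>
    rw [heightSeries_zero, map_one]
    ring
  | succ h ih =>
    have h1 := congrArg kernelSubst (heightSeries_succ h)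
    simp only [map_mul, map_add, map_sub, map_one, kernelSubst_X] at h1
    set f := kernelSubst (heightSeries h)
    set g := kernelSubst (heightSeries (h + 1))
    have h2 : (1 + X) ^ 2 * g = (1 + X) ^ 2 + X * (f * g) := by
      linear_combination kernelSeries * h1 + (X * g - X + X * (f * g)) * kernelSeries_mul_inv
        + (1 - g) * kernelSeries_eq
    have h0 : (1 + X : ℂ⟦X⟧) ≠ 0 := by
      intro h0
      simpa using congrArg constantCoeff h0
    refine mul_left_cancel₀ h0 ?_
    linear_combination (1 - X ^ (h + 2)) * h2 + X * g * ih

/-- Since `1 - u² = Φ - u Φ'` for `Φ = 1 + 3 u + u²`, the series `Φ ^ q (1 - u²)` is `Φ ^ (q + 1) -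
u (Φ ^ (q + 1))' / (q + 1)`, in which the coefficient of index `q + 1` cancels. -/
theorem coeff_kernelSeries_pow_mul (q : ℕ) :
    coeff (q + 1) (kernelSeries ^ q * (1 - X ^ 2)) = 0 := by
  have hd : d⁄dX ℂ kernelSeries = 3 + 2 * X := by
    rw [kernelSeries_eq]
    simp only [map_add, Derivation.leibniz, Derivation.leibniz_pow, derivative_X]
    have h3 : d⁄dX ℂ (3 : ℂ⟦X⟧) = 0 := by
      simpa using Derivation.map_natCast (d⁄dX ℂ) 3
    simp [h3]
  have h1 : kernelSeries ^ q * (1 - X ^ 2) * C ((q : ℂ) + 1) =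
      kernelSeries ^ (q + 1) * C ((q : ℂ) + 1) - X * d⁄dX ℂ (kernelSeries ^ (q + 1)) := by
    rw [Derivation.leibniz_pow, hd, Nat.add_sub_cancel]
    simp only [nsmul_eq_mul, smul_eq_mul, map_add, map_one, map_natCast, Nat.cast_add, Nat.cast_one]
    linear_combination (-kernelSeries ^ q * ((q : ℂ⟦X⟧) + 1)) * kernelSeries_eq
  have h2 := congrArg (coeff (q + 1)) h1
  rw [map_sub, coeff_mul_C, coeff_mul_C, coeff_succ_X_mul, coeff_derivative, sub_self] at h2
  exact (mul_eq_zero.1 h2).resolve_right (Nat.cast_add_one_ne_zero q)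

theorem coeff_X_mul_inv_pow_mul (N k : ℕ) (hk : k ≤ N + 1) :
    coeff (N + 1) ((X * kernelSeries⁻¹) ^ k * (kernelSeries ^ N * (1 - X ^ 2))) =
      if N + 1 = k then 1 else 0 := by
  rcases hk.lt_or_eq with hk | rfl
  · rw [if_neg hk.ne']
    obtain ⟨q, rfl⟩ := Nat.exists_eq_add_of_le (Nat.lt_succ_iff.1 hk)
    have h1 : (X * kernelSeries⁻¹) ^ k * (kernelSeries ^ (k + q) * (1 - X ^ 2)) =
        X ^ k * (kernelSeries ^ q * (1 - X ^ 2)) := by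
      have : kernelSeries ^ k * kernelSeries⁻¹ ^ k = 1 := by
        rw [← mul_pow, kernelSeries_mul_inv, one_pow]
      rw [mul_pow, pow_add]
      linear_combination (X ^ k * (kernelSeries ^ q * (1 - X ^ 2))) * this
    rw [h1, show k + q + 1 = (q + 1) + k by ring, coeff_X_pow_mul, coeff_kernelSeries_pow_mul]
  · rw [if_pos rfl, mul_pow, mul_assoc]
    have := coeff_X_pow_mul (kernelSeries⁻¹ ^ (N + 1) * (kernelSeries ^ N * (1 - X ^ 2))) (N + 1) 0
    rw [zero_add] at this
    rw [this, coeff_zero_eq_constantCoeff_apply]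
    simp [kernelSeries_eq]

/-- Lagrange inversion for the substitution `z = u / (1 + 3 u + u²)`. -/
theorem coeff_eq_coeff_kernelSubst (N : ℕ) (f : ℂ⟦X⟧) :
    coeff (N + 1) f = coeff (N + 1) (kernelSubst f * (kernelSeries ^ N * (1 - X ^ 2))) := by
  obtain ⟨g, hg⟩ : X ^ (N + 2) ∣ f - (trunc (N + 2) f : ℂ⟦X⟧) := by
    rw [X_pow_dvd_iff]
    intro m hm
    rw [map_sub, coeff_coe_trunc_of_lt hm, sub_self]
  have hf : f = (trunc (N + 2) f : ℂ⟦X⟧) + X ^ (N + 2) * g := by rw [← hg]; ring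
  have h1 : kernelSubst f = ∑ k ∈ Finset.range (N + 2), C (coeff k f) * (X * kernelSeries⁻¹) ^ k +
      X ^ (N + 2) * (kernelSeries⁻¹ ^ (N + 2) * kernelSubst g) := by
    conv_lhs => rw [hf]
    rw [map_add, map_mul, map_pow, kernelSubst_X, mul_pow, mul_assoc]
    congr 1
    refine (substAlgHom_coe hasSubst_X_mul_inv (trunc (N + 2) f)).trans ?_
    rw [trunc_apply, Finset.range_eq_Ico, map_sum]
    refine Finset.sum_congr rfl fun k _ => ?_
    exact Polynomial.aeval_monomial _
  rw [h1, add_mul, map_add, mul_assoc (X ^ (N + 2)), coeff_X_pow_mul', if_neg (by omega), add_zero,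
    Finset.sum_mul, map_sum]
  rw [Finset.sum_congr rfl fun k hk => by
    rw [mul_assoc, coeff_C_mul, coeff_X_mul_inv_pow_mul N k (by
      have := Finset.mem_range.1 hk
      omega)]]
  simp

theorem isUnit_one_sub_X_pow (k : ℕ) : IsUnit (1 - X ^ (k + 1) : ℂ⟦X⟧) := by
  rw [isUnit_iff_constantCoeff]
  simp

theorem one_sub_mul_sum_pow (Y : ℂ⟦X⟧) (M : ℕ) :
    (1 - Y) * ∑ m ∈ Finset.range M, Y ^ (m + 1) = Y - Y ^ (M + 1) := by
  induction M with
  | zero => simp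
  | succ M ih =>
    rw [Finset.sum_range_succ, mul_add, ih]
    ring

/-- The polynomial whose coefficient of index `n + 1` is the `m`-th term in the number of trees
with `n` edges and height `h`. -/
noncomputable def termPoly (n h m : ℕ) : Polynomial ℂ :=
  (1 - Polynomial.X ^ 2) ^ 2 * kernelPoly ^ (n - 1) *
    (Polynomial.X ^ (m * (h + 1)) - Polynomial.X ^ (m * (h + 2)))

theorem coeff_termPoly_eq_zero {n h m : ℕ} (hm : n + 1 < m * (h + 1)) :
    (termPoly n h m).coeff (n + 1) = 0 := by
  have e : termPoly n h m = Polynomial.X ^ (m * (h + 1)) *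
      ((1 - Polynomial.X ^ 2) ^ 2 * kernelPoly ^ (n - 1) * (1 - Polynomial.X ^ m)) := by
    rw [termPoly]
    ring
  rw [e, Polynomial.coeff_X_pow_mul', if_neg (by omega)]

/-- The geometric series of `1 / (1 - u ^ (h + 1)) - 1 / (1 - u ^ (h + 2))` gives the sum over `m`;
terms with `m > n + 1` do not reach the coefficient of index `n + 1`. -/
theorem ncard_eq_sum_coeff {n h : ℕ} (hn : 1 ≤ n) (hh : 1 ≤ h) :
    ({T : MultiEdgeTree | T.size = n ∧ T.height = h}.ncard : ℂ) =
      ∑ m ∈ Finset.range (n + 1), (termPoly n h (m + 1)).coeff (n + 1) := by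
  obtain ⟨N, rfl⟩ := Nat.exists_eq_add_of_le' hn
  obtain ⟨h, rfl⟩ := Nat.exists_eq_add_of_le' hh
  have h1 := congrArg (Nat.cast : ℕ → ℂ) (ncard_height_eq h (N + 1))
  push_cast at h1
  have h2 : ({T : MultiEdgeTree | T.size = N + 1 ∧ T.height = h + 1}.ncard : ℂ) =
      coeff (N + 1) (heightSeries (h + 1) - heightSeries h) := by
    simp only [heightSeries, map_sub, coeff_mk]
    linear_combination h1
  set f := kernelSubst (heightSeries h) with hf
  set g := kernelSubst (heightSeries (h + 1)) with hg
  set D : ℕ → ℂ⟦X⟧ := fun k => ∑ m ∈ Finset.range (N + 2), (X ^ k) ^ (m + 1) with hD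
  have hD' : ∀ k, (1 - X ^ k) * D k = X ^ k - (X ^ k) ^ (N + 3) := fun k =>
    one_sub_mul_sum_pow _ _
  have hdvd : X ^ (N + 3) ∣ X * (g - f) - (1 - X ^ 2) * (D (h + 2) - D (h + 3)) := by
    refine ((isUnit_one_sub_X_pow (h + 1)).mul (isUnit_one_sub_X_pow (h + 2))).dvd_mul_right.1 ?_
    refine ⟨(1 - X ^ 2) * ((X ^ (h + 1)) ^ (N + 3) * (1 - X ^ (h + 3)) -
      (X ^ (h + 2)) ^ (N + 3) * (1 - X ^ (h + 2))), ?_⟩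
    have e1 := kernelSubst_heightSeries h
    have e2 := kernelSubst_heightSeries (h + 1)
    have e3 := hD' (h + 2)
    have e4 := hD' (h + 3)
    rw [← hf] at e1
    rw [← hg] at e2
    linear_combination X * (1 - X ^ (h + 2)) * e2 - X * (1 - X ^ (h + 3)) * e1
      - (1 - X ^ 2) * (1 - X ^ (h + 3)) * e3 + (1 - X ^ 2) * (1 - X ^ (h + 2)) * e4
  obtain ⟨R, hR⟩ := hdvd
  rw [h2, coeff_eq_coeff_kernelSubst, map_sub, ← hf, ← hg, ← coeff_succ_X_mul, ← mul_assoc,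
    sub_eq_iff_eq_add.1 hR, add_mul, map_add, mul_assoc (X ^ (N + 3)), coeff_X_pow_mul',
    if_neg (by omega), zero_add]
  have hsum : (1 - X ^ 2) * (D (h + 2) - D (h + 3)) * (kernelSeries ^ N * (1 - X ^ 2)) =
      ∑ m ∈ Finset.range (N + 2), ((termPoly (N + 1) (h + 1) (m + 1) : Polynomial ℂ) : ℂ⟦X⟧) := by
    simp only [hD, ← Finset.sum_sub_distrib, Finset.mul_sum, Finset.sum_mul]
    refine Finset.sum_congr rfl fun m _ => ?_
    simp only [termPoly, Polynomial.coe_mul, Polynomial.coe_pow, Polynomial.coe_sub,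
      Polynomial.coe_one, Polynomial.coe_X, Nat.add_sub_cancel, kernelSeries]
    rw [← pow_mul, ← pow_mul]
    ring
  rw [hsum, map_sum]
  simp only [Polynomial.coeff_coe]

/-- The polynomial whose coefficient of index `n` is the number of trees with `n` edges. -/
noncomputable def totalPoly (n : ℕ) : Polynomial ℂ :=
  (1 + Polynomial.X) * (1 - Polynomial.X ^ 2) * kernelPoly ^ (n - 1)

theorem ncard_eq_coeff_totalPoly {n : ℕ} (hn : 1 ≤ n) :
    ({T : MultiEdgeTree | T.size = n}.ncard : ℂ) = (totalPoly n).coeff n := by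
  obtain ⟨N, rfl⟩ := Nat.exists_eq_add_of_le' hn
  have h2 : ({T : MultiEdgeTree | T.size = N + 1}.ncard : ℂ) =
      coeff (N + 1) (heightSeries (N + 1)) := by
    simp only [heightSeries, coeff_mk, ncard_size_eq]
  set f := kernelSubst (heightSeries (N + 1)) with hf
  have hdvd : X ^ (N + 2) ∣ f - (1 + X) := by
    refine (isUnit_one_sub_X_pow (N + 2)).dvd_mul_right.1 ⟨(1 + X) * (X - 1), ?_⟩
    have e1 := kernelSubst_heightSeries (N + 1)
    rw [← hf] at e1
    linear_combination e1
  obtain ⟨R, hR⟩ := hdvd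
  rw [h2, coeff_eq_coeff_kernelSubst, ← hf, sub_eq_iff_eq_add.1 hR, add_mul, map_add,
    mul_assoc (X ^ (N + 2)), coeff_X_pow_mul', if_neg (by omega), zero_add, ← Polynomial.coeff_coe]
  congr 1
  simp only [totalPoly, Polynomial.coe_mul, Polynomial.coe_pow, Polynomial.coe_sub,
    Polynomial.coe_add, Polynomial.coe_one, Polynomial.coe_X, Nat.add_sub_cancel, kernelSeries]
  ring

end MultiEdgeTree

namespace MultiEdgeTree

open Complex

/-! ### The integrand near the saddle point -/

/-- Termwise comparison of power series, by `2 · 5 ^ k · k! ≤ 5 (2 k)!` for `k ≥ 1`. -/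
theorem three_add_two_cosh_le (s : ℝ) : (3 + 2 * Real.cosh s) / 5 ≤ Real.exp (s ^ 2 / 5) := by
  have h1 : HasSum (fun n : ℕ => (if n = 0 then 3 / 5 else 0) +
      2 / 5 * (s ^ (2 * n) / ((2 * n).factorial : ℝ))) (3 / 5 + 2 / 5 * Real.cosh s) :=
    (hasSum_ite_eq 0 _).add ((Real.hasSum_cosh s).mul_left _)
  have h2 : HasSum (fun n : ℕ => (s ^ 2 / 5) ^ n / (n.factorial : ℝ)) (Real.exp (s ^ 2 / 5)) := by
    rw [Real.exp_eq_exp_ℝ]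
    exact NormedSpace.expSeries_div_hasSum_exp (s ^ 2 / 5)
  have h3 := hasSum_le (fun n => ?_) h1 h2
  · linarith
  · have key : ∀ k : ℕ, 2 * (5 ^ (k + 1) * (k + 1).factorial) ≤ 5 * (2 * (k + 1)).factorial := by
      intro k
      induction k with
      | zero => simp [Nat.factorial]
      | succ k ih =>
        have e : (2 * (k + 1 + 1)).factorial =
            (2 * k + 4) * ((2 * k + 3) * (2 * (k + 1)).factorial) := by
          rw [show 2 * (k + 1 + 1) = 2 * (k + 1) + 1 + 1 by ring, Nat.factorial_succ,
            Nat.factorial_succ]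
          ring
        rw [e, Nat.factorial_succ (k + 1), pow_succ]
        calc 2 * (5 ^ (k + 1) * 5 * ((k + 1 + 1) * (k + 1).factorial))
            = 5 * (k + 2) * (2 * (5 ^ (k + 1) * (k + 1).factorial)) := by ring
          _ ≤ 5 * (k + 2) * (5 * (2 * (k + 1)).factorial) := by gcongr
          _ = 5 * ((5 * k + 10) * (2 * (k + 1)).factorial) := by ring
          _ ≤ 5 * (((2 * k + 4) * (2 * k + 3)) * (2 * (k + 1)).factorial) := by
            gcongr
            nlinarith
          _ = _ := by ring
    rcases n with _ | k
    · norm_num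
    · have hk : (2 : ℝ) * (5 ^ (k + 1) * (k + 1).factorial) ≤ 5 * (2 * (k + 1)).factorial := by
        exact_mod_cast key k
      rw [if_neg (Nat.succ_ne_zero k), zero_add, div_pow, ← pow_mul, div_div, div_mul_div_comm,
        div_le_div_iff₀ (by positivity) (by positivity)]
      have hs : 0 ≤ s ^ (2 * (k + 1)) := by
        rw [pow_mul]
        positivity
      nlinarith [mul_le_mul_of_nonneg_left hk hs]

/-- The normalized kernel `(u + 3 + u⁻¹) / 5` at `u = exp (i z)`. -/
noncomputable def cosKernel (z : ℂ) : ℂ := (3 + 2 * cos z) / 5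

/-- The Gaussian that agrees with `cosKernel` to third order at the origin. -/
noncomputable def gaussKernel (z : ℂ) : ℂ := exp (-z ^ 2 / 5)

theorem norm_gaussKernel (θ s : ℝ) :
    ‖gaussKernel (θ + s * I)‖ = Real.exp (s ^ 2 / 5 - θ ^ 2 / 5) := by
  rw [gaussKernel, norm_exp]
  congr 1
  have : (-((θ : ℂ) + s * I) ^ 2 / 5) = ((s ^ 2 / 5 - θ ^ 2 / 5 : ℝ) : ℂ) +
      ((-2 * θ * s / 5 : ℝ) : ℂ) * I := by
    push_cast
    linear_combination (-(s : ℂ) ^ 2 / 5) * I_sq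
  rw [this, add_re, ofReal_re, re_ofReal_mul, I_re, mul_zero, add_zero]

theorem norm_gaussKernel_le (θ s : ℝ) :
    ‖gaussKernel (θ + s * I)‖ ≤ Real.exp (s ^ 2 / 5 - θ ^ 2 / 500) := by
  rw [norm_gaussKernel, Real.exp_le_exp]
  nlinarith [sq_nonneg θ]

theorem pi_sq_le_ten : Real.pi ^ 2 ≤ 10 := by
  have h1 := Real.pi_lt_d2
  have h2 := Real.pi_pos
  nlinarith

/-- The squared norm falls short of `((3 + 2 cosh s) / 5)²` by at least a multiple of `1 - cos θ`,
and `1 - cos θ ≥ 2 θ² / π²`. The constant `500` is not optimal; `|s| ≤ 5 / 2` is the range of the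
saddle points. -/
theorem norm_cosKernel_le {θ s : ℝ} (hθ : |θ| ≤ Real.pi) (hs : |s| ≤ 5 / 2) :
    ‖cosKernel (θ + s * I)‖ ≤ Real.exp (s ^ 2 / 5 - θ ^ 2 / 500) := by
  have h1 : 3 + 2 * cos (θ + s * I) = ((3 + 2 * (Real.cos θ * Real.cosh s) : ℝ) : ℂ) +
      ((-2 * (Real.sin θ * Real.sinh s) : ℝ) : ℂ) * I := by
    rw [cos_add_mul_I]
    push_cast
    ring
  have h2 : ‖cosKernel (θ + s * I)‖ ^ 2 = ((3 + 2 * (Real.cos θ * Real.cosh s)) ^ 2 +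
      (-2 * (Real.sin θ * Real.sinh s)) ^ 2) / 25 := by
    rw [cosKernel, h1, norm_div, div_pow, ← normSq_eq_norm_sq, normSq_add_mul_I]
    norm_num
  have hc := Real.cos_le_one_sub_mul_cos_sq hθ
  have hch := Real.one_le_cosh s
  have hsh := Real.cosh_sq s
  have hsc := Real.sin_sq_add_cos_sq θ
  have hc1 := Real.cos_le_one θ
  have hc2 := Real.neg_one_le_cos θ
  have h3 : θ ^ 2 / 5 ≤ 2 / Real.pi ^ 2 * θ ^ 2 := by
    have : 1 / 5 ≤ 2 / Real.pi ^ 2 := by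
      rw [div_le_div_iff₀ (by norm_num) (by positivity)]
      linarith [pi_sq_le_ten]
    nlinarith [sq_nonneg θ]
  have h4 : (3 + 2 * (Real.cos θ * Real.cosh s)) ^ 2 + (-2 * (Real.sin θ * Real.sinh s)) ^ 2 =
      (3 + 2 * Real.cosh s) ^ 2 - 12 * (Real.cosh s * (1 - Real.cos θ)) -
        4 * (1 - Real.cos θ) * (1 + Real.cos θ) := by
    have e1 : Real.sin θ ^ 2 = 1 - Real.cos θ ^ 2 := by linarith
    have e2 : Real.sinh s ^ 2 = Real.cosh s ^ 2 - 1 := by linarith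
    linear_combination 4 * Real.sinh s ^ 2 * e1 + 4 * (1 - Real.cos θ ^ 2) * e2
  set E : ℝ := Real.exp (s ^ 2 / 5) ^ 2 with hE
  have h5 : ((3 + 2 * Real.cosh s) / 5) ^ 2 ≤ E :=
    pow_le_pow_left₀ (by linarith) (three_add_two_cosh_le s) 2
  have h6 : ‖cosKernel (θ + s * I)‖ ^ 2 ≤ E - 12 / 125 * θ ^ 2 := by
    rw [h2, h4]
    nlinarith [mul_nonneg (sub_nonneg.2 hc1) (by linarith : 0 ≤ 1 + Real.cos θ),
      mul_nonneg (sub_nonneg.2 hch) (sub_nonneg.2 hc1)]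
  have hE24 : E ≤ 24 := by
    have hs2 : s ^ 2 ≤ (5 / 2) ^ 2 := by
      rw [← sq_abs]
      exact pow_le_pow_left₀ (abs_nonneg s) hs 2
    have e1 : E ≤ Real.exp 1 ^ 3 := by
      rw [hE, ← Real.exp_nat_mul, ← Real.exp_nat_mul, Real.exp_le_exp]
      push_cast
      linarith
    have e2 : Real.exp 1 ^ 3 ≤ 2.72 ^ 3 :=
      pow_le_pow_left₀ (Real.exp_pos _).le (by linarith [Real.exp_one_lt_d9]) 3
    exact e1.trans (e2.trans (by norm_num))
  have hE0 : 0 < E := by positivity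
  have h7 : E - 12 / 125 * θ ^ 2 ≤ E * Real.exp (-(θ ^ 2 / 250)) := by
    have := Real.add_one_le_exp (-(θ ^ 2 / 250))
    nlinarith [mul_le_mul_of_nonneg_left this hE0.le, sq_nonneg θ,
      mul_nonneg (sub_nonneg.2 hE24) (sq_nonneg θ)]
  refine le_of_sq_le_sq ?_ (Real.exp_pos _).le
  refine (h6.trans h7).trans_eq ?_
  rw [hE, ← Real.exp_nat_mul, ← Real.exp_nat_mul, ← Real.exp_add]
  congr 1
  push_cast
  ring

/-- A bound `C ‖z‖ ^ k` on the unit disc extends to the disc of radius `6`, for a continuous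
function and with another constant. -/
theorem exists_norm_le_mul_pow {f : ℂ → ℂ} (hf : Continuous f) (k : ℕ) (C : ℝ)
    (h1 : ∀ z, ‖z‖ ≤ 1 → ‖f z‖ ≤ C * ‖z‖ ^ k) :
    ∃ D : ℝ, 0 < D ∧ ∀ z, ‖z‖ ≤ 6 → ‖f z‖ ≤ D * ‖z‖ ^ k := by
  obtain ⟨K, hK⟩ := (isCompact_closedBall (0 : ℂ) 6).exists_bound_of_continuousOn hf.continuousOn
  refine ⟨max (max C K) 1, by positivity, fun z hz => ?_⟩
  rcases le_total ‖z‖ 1 with h | h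
  · exact (h1 z h).trans (by gcongr; exact (le_max_left _ _).trans (le_max_left _ _))
  · calc ‖f z‖ ≤ K := hK z (by simpa using hz)
      _ ≤ max (max C K) 1 := (le_max_right _ _).trans (le_max_left _ _)
      _ ≤ max (max C K) 1 * ‖z‖ ^ k :=
        le_mul_of_one_le_right (by positivity) (one_le_pow₀ h)

theorem continuous_cosKernel : Continuous cosKernel := by
  unfold cosKernel
  fun_prop

theorem continuous_gaussKernel : Continuous gaussKernel := by
  unfold gaussKernel
  fun_prop

theorem exists_norm_cosKernel_sub_gaussKernel_le :
    ∃ D : ℝ, 0 < D ∧ ∀ z, ‖z‖ ≤ 6 → ‖cosKernel z - gaussKernel z‖ ≤ D * ‖z‖ ^ 4 := by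
  refine exists_norm_le_mul_pow (f := fun z => cosKernel z - gaussKernel z)
    (continuous_cosKernel.sub continuous_gaussKernel) 4 1 fun z hz => ?_
  have h1 := cos_bound hz
  have hw : ‖-z ^ 2 / 5‖ = ‖z‖ ^ 2 / 5 := by simp
  have hz2 : ‖z‖ ^ 2 ≤ 1 := pow_le_one₀ (norm_nonneg z) hz
  have h2 := norm_exp_sub_one_sub_id_le (x := -z ^ 2 / 5) (by rw [hw]; linarith)
  have e : cosKernel z - gaussKernel z = 2 / 5 * (cos z - (1 - z ^ 2 / 2)) -
      (exp (-z ^ 2 / 5) - 1 - -z ^ 2 / 5) := by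
    rw [cosKernel, gaussKernel]
    ring
  rw [e]
  refine (norm_sub_le _ _).trans ?_
  rw [norm_mul]
  rw [hw] at h2
  norm_num at h1 h2 ⊢
  nlinarith [pow_nonneg (norm_nonneg z) 4]

theorem exists_norm_one_sub_gaussKernel_le :
    ∃ D : ℝ, 0 < D ∧ ∀ z, ‖z‖ ≤ 6 → ‖1 - gaussKernel z‖ ≤ D * ‖z‖ ^ 2 := by
  refine exists_norm_le_mul_pow (f := fun z => 1 - gaussKernel z)
    (continuous_const.sub continuous_gaussKernel) 2 1 fun z hz => ?_
  have hw : ‖-z ^ 2 / 5‖ = ‖z‖ ^ 2 / 5 := by simp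
  have hz2 : ‖z‖ ^ 2 ≤ 1 := pow_le_one₀ (norm_nonneg z) hz
  have h2 := norm_exp_sub_one_le (x := -z ^ 2 / 5) (by rw [hw]; linarith)
  rw [gaussKernel, norm_sub_rev]
  rw [hw] at h2
  nlinarith [sq_nonneg ‖z‖]

theorem exists_norm_sin_sub_le :
    ∃ D : ℝ, 0 < D ∧ ∀ z, ‖z‖ ≤ 6 → ‖sin z - z‖ ≤ D * ‖z‖ ^ 3 := by
  refine exists_norm_le_mul_pow (f := fun z => sin z - z)
    (continuous_sin.sub continuous_id) 3 1 fun z hz => ?_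
  have h1 := sin_bound hz
  have e : sin z - z = (sin z - (z - z ^ 3 / 6)) - z ^ 3 / 6 := by ring
  rw [e]
  refine (norm_sub_le _ _).trans ?_
  have h3 : ‖z ^ 3 / 6‖ = ‖z‖ ^ 3 / 6 := by simp
  have h5 : ‖z‖ ^ 5 ≤ ‖z‖ ^ 3 := pow_le_pow_of_le_one (norm_nonneg z) hz (by norm_num)
  rw [h3]
  nlinarith [pow_nonneg (norm_nonneg z) 3]

theorem exists_norm_sin_le :
    ∃ D : ℝ, 0 < D ∧ ∀ z, ‖z‖ ≤ 6 → ‖sin z‖ ≤ D * ‖z‖ := by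
  obtain ⟨D, hD, h⟩ := exists_norm_sin_sub_le
  refine ⟨D * 36 + 1, by positivity, fun z hz => ?_⟩
  have e : sin z = (sin z - z) + z := by ring
  rw [e]
  refine (norm_add_le _ _).trans ((add_le_add_left (h z hz) _).trans ?_)
  have h2 : ‖z‖ ^ 2 ≤ 6 ^ 2 := pow_le_pow_left₀ (norm_nonneg z) hz 2
  have := mul_le_mul_of_nonneg_left h2 (mul_nonneg hD.le (norm_nonneg z))
  nlinarith

theorem norm_exp_sub_one_le_of_re_nonpos {w : ℂ} (hw : w.re ≤ 0) : ‖exp w - 1‖ ≤ 2 * ‖w‖ := by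
  rcases le_total ‖w‖ 1 with h | h
  · exact norm_exp_sub_one_le h
  · have h1 : ‖exp w‖ ≤ 1 := by rwa [norm_exp, Real.exp_le_one_iff]
    refine (norm_sub_le _ _).trans ?_
    rw [norm_one]
    linarith

theorem norm_exp_sub_one_sub_le_of_re_nonpos {w : ℂ} (hw : w.re ≤ 0) :
    ‖exp w - 1 - w‖ ≤ 3 * ‖w‖ ^ 2 := by
  rcases le_total ‖w‖ 1 with h | h
  · exact (norm_exp_sub_one_sub_id_le h).trans (by nlinarith [sq_nonneg ‖w‖])
  · have h1 := norm_exp_sub_one_le_of_re_nonpos hw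
    refine (norm_sub_le _ _).trans ?_
    nlinarith

/-- Powers of nearby numbers stay close, with the loss measured by a common bound on their norms. -/
theorem norm_pow_sub_pow_le {a b : ℂ} {M : ℝ} (ha : ‖a‖ ≤ M) (hb : ‖b‖ ≤ M) (N : ℕ) :
    ‖a ^ (N + 1) - b ^ (N + 1)‖ ≤ (N + 1) * ‖a - b‖ * M ^ N := by
  have hM : 0 ≤ M := (norm_nonneg a).trans ha
  induction N with
  | zero => simp
  | succ N ih =>
    have e : a ^ (N + 1 + 1) - b ^ (N + 1 + 1) =
        a * (a ^ (N + 1) - b ^ (N + 1)) + (a - b) * b ^ (N + 1) := by ring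
    rw [e]
    refine (norm_add_le _ _).trans ?_
    rw [norm_mul, norm_mul, norm_pow]
    calc ‖a‖ * ‖a ^ (N + 1) - b ^ (N + 1)‖ + ‖a - b‖ * ‖b‖ ^ (N + 1)
        ≤ M * ((N + 1) * ‖a - b‖ * M ^ N) + ‖a - b‖ * M ^ (N + 1) := by gcongr
      _ = _ := by
        push_cast
        ring

theorem norm_add_mul_I_le (θ s : ℝ) (hs : 0 ≤ s) : ‖(θ : ℂ) + s * I‖ ≤ |θ| + s := by
  refine (norm_add_le _ _).trans_eq ?_
  simp [abs_of_nonneg hs]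

theorem norm_add_mul_I_le_six {θ s : ℝ} (hθ : |θ| ≤ Real.pi) (hs : 0 ≤ s) (hs' : s ≤ 5 / 2) :
    ‖(θ : ℂ) + s * I‖ ≤ 6 := by
  have := norm_add_mul_I_le θ s hs
  linarith [Real.pi_lt_d2]

/-- The Gaussian approximation to the powers of the kernel on the segment of length `2π` through
`s i`. -/
theorem exists_norm_cosKernel_pow_sub_le : ∃ D : ℝ, 0 < D ∧ ∀ (n : ℕ) (θ s : ℝ), 2 ≤ n →
    |θ| ≤ Real.pi → 0 ≤ s → s ≤ 5 / 2 →
    ‖cosKernel (θ + s * I) ^ (n - 1) - gaussKernel (θ + s * I) ^ n‖ ≤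
      D * (n * ‖(θ : ℂ) + s * I‖ ^ 4 + ‖(θ : ℂ) + s * I‖ ^ 2) *
        Real.exp (n * (s ^ 2 / 5 - θ ^ 2 / 500)) := by
  obtain ⟨D₁, hD₁, h₁⟩ := exists_norm_cosKernel_sub_gaussKernel_le
  obtain ⟨D₂, hD₂, h₂⟩ := exists_norm_one_sub_gaussKernel_le
  refine ⟨4 * D₁ + 2 * D₂, by positivity, fun n θ s hn hθ hs hs' => ?_⟩
  obtain ⟨N, rfl⟩ := Nat.exists_eq_add_of_le' hn
  have hz := norm_add_mul_I_le_six hθ hs hs'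
  have hA := norm_cosKernel_le hθ (abs_le.2 ⟨by linarith, hs'⟩)
  have hB := norm_gaussKernel_le θ s
  set z : ℂ := (θ : ℂ) + s * I
  set M : ℝ := Real.exp (s ^ 2 / 5 - θ ^ 2 / 500) with hM
  have hM2 : 1 ≤ 2 * M := by
    have h1 := Real.add_one_le_exp (s ^ 2 / 5 - θ ^ 2 / 500)
    have h2 : θ ^ 2 ≤ 10 := by
      rw [← sq_abs]
      exact (pow_le_pow_left₀ (abs_nonneg θ) hθ 2).trans pi_sq_le_ten
    nlinarith [sq_nonneg s]
  have hM0 : 0 < M := Real.exp_pos _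
  have hMn : Real.exp (((N + 2 : ℕ) : ℝ) * (s ^ 2 / 5 - θ ^ 2 / 500)) = M ^ (N + 2) := by
    rw [hM, ← Real.exp_nat_mul]
  have hM3 : M ^ (N + 1) ≤ 2 * M ^ (N + 2) := by
    rw [pow_succ _ (N + 1)]
    nlinarith [pow_pos hM0 (N + 1)]
  have hM4 : M ^ N ≤ 4 * M ^ (N + 2) := by
    have : M ^ N ≤ 2 * M ^ (N + 1) := by
      rw [pow_succ]
      nlinarith [pow_pos hM0 N]
    linarith
  rw [hMn]
  have e : cosKernel z ^ (N + 2 - 1) - gaussKernel z ^ (N + 2) =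
      (cosKernel z ^ (N + 1) - gaussKernel z ^ (N + 1)) +
        gaussKernel z ^ (N + 1) * (1 - gaussKernel z) := by
    rw [show N + 2 - 1 = N + 1 by omega]
    ring
  rw [e]
  refine (norm_add_le _ _).trans ?_
  rw [norm_mul, norm_pow]
  have hzn := norm_nonneg z
  calc ‖cosKernel z ^ (N + 1) - gaussKernel z ^ (N + 1)‖ +
        ‖gaussKernel z‖ ^ (N + 1) * ‖1 - gaussKernel z‖
      ≤ (N + 1) * (D₁ * ‖z‖ ^ 4) * M ^ N + M ^ (N + 1) * (D₂ * ‖z‖ ^ 2) := by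
        refine add_le_add ((norm_pow_sub_pow_le hA hB N).trans ?_) ?_
        · gcongr
          exact h₁ z hz
        · gcongr
          exact h₂ z hz
    _ ≤ (N + 2) * (D₁ * ‖z‖ ^ 4) * (4 * M ^ (N + 2)) + (2 * M ^ (N + 2)) * (D₂ * ‖z‖ ^ 2) := by
        gcongr
        norm_num
    _ ≤ _ := by
        push_cast
        have h1 : 0 ≤ M ^ (N + 2) * (2 * D₂ * ((N + 2) * ‖z‖ ^ 4) + 4 * D₁ * ‖z‖ ^ 2) := by
          positivity
        linarith

end MultiEdgeTree

namespace MultiEdgeTree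

open Complex MeasureTheory

/-! ### Coefficients as integrals -/

theorem integral_exp_int_mul (k : ℤ) :
    ∫ θ in (-Real.pi)..Real.pi, exp (k * I * (θ : ℂ)) = if k = 0 then (2 * Real.pi : ℂ) else 0 := by
  split_ifs with hk
  · simp only [hk, Int.cast_zero, zero_mul, exp_zero, intervalIntegral.integral_const, real_smul]
    push_cast
    ring
  · rw [integral_exp_mul_complex (mul_ne_zero (Int.cast_ne_zero.2 hk) I_ne_zero)]
    have : exp (k * I * (Real.pi : ℂ)) = exp (k * I * ((-Real.pi : ℝ) : ℂ)) := by
      rw [exp_eq_exp_iff_exists_int]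
      refine ⟨k, ?_⟩
      push_cast
      ring
    rw [this, sub_self, zero_div]

/-- Cauchy's formula for the coefficients of a polynomial, on the circle of radius `exp (-s)`. -/
theorem integral_eval_mul_exp (Q : Polynomial ℂ) (k : ℕ) (s : ℝ) :
    ∫ θ in (-Real.pi)..Real.pi, Q.eval (exp ((θ + s * I) * I)) * exp (-k * ((θ + s * I) * I)) =
      2 * Real.pi * Q.coeff k := by
  induction Q using Polynomial.induction_on' with
  | add p q hp hq =>
    simp only [Polynomial.eval_add, add_mul, Polynomial.coeff_add, mul_add] at hp hq ⊢
    rw [intervalIntegral.integral_add, hp, hq]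
    · exact Continuous.intervalIntegrable (by fun_prop) _ _
    · exact Continuous.intervalIntegrable (by fun_prop) _ _
  | monomial l a =>
    have h1 : ∀ θ : ℝ, (Polynomial.monomial l a).eval (exp ((θ + s * I) * I)) *
        exp (-k * ((θ + s * I) * I)) =
        a * exp (-((l : ℂ) - k) * s) * exp (((l - k : ℤ) : ℂ) * I * (θ : ℂ)) := by
      intro θ
      rw [Polynomial.eval_monomial, ← exp_nat_mul, mul_assoc, mul_assoc, ← exp_add, ← exp_add]
      congr 2
      push_cast
      linear_combination ((l : ℂ) - k) * s * I_sq
    simp_rw [h1]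
    rw [intervalIntegral.integral_const_mul, integral_exp_int_mul, Polynomial.coeff_monomial]
    by_cases hlk : l = k
    · subst hlk
      simp
      ring
    · rw [if_neg (by omega), if_neg hlk]
      simp

theorem eval_kernelPoly_mul_exp (z : ℂ) :
    kernelPoly.eval (exp (z * I)) * exp (-z * I) = 5 * cosKernel z := by
  have h1 : exp (z * I) * exp (-z * I) = 1 := by
    rw [← exp_add]
    simp
  have h2 := two_cos z
  simp only [kernelPoly, Polynomial.eval_add, Polynomial.eval_mul, Polynomial.eval_pow,
    Polynomial.eval_X, Polynomial.eval_one, Polynomial.eval_ofNat, cosKernel]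
  linear_combination (3 + exp (z * I)) * h1 - h2

theorem one_sub_exp_sq_mul_exp (z : ℂ) :
    (1 - exp (z * I) ^ 2) * exp (-z * I) = -2 * I * sin z := by
  have h1 : exp (z * I) * exp (-z * I) = 1 := by
    rw [← exp_add]
    simp
  have h2 := two_sin z
  linear_combination (-exp (z * I)) * h1 + I * h2 + (exp (-z * I) - exp (z * I)) * I_sq

/-- The integrand of the `m`-th term of the count of trees of height `h`. -/
noncomputable def termIntegrand (n h m : ℕ) (z : ℂ) : ℂ :=
  cosKernel z ^ (n - 1) * (-4 * sin z ^ 2 *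
    (exp ((m * h : ℝ) * (z * I)) * (exp (m * (z * I)) - exp (m * (z * I)) ^ 2)))

theorem integral_termIntegrand (n h m : ℕ) (hn : 1 ≤ n) (s : ℝ) :
    ∫ θ in (-Real.pi)..Real.pi, termIntegrand n h m (θ + s * I) =
      2 * Real.pi * (termPoly n h m).coeff (n + 1) / 5 ^ (n - 1) := by
  rw [eq_div_iff (pow_ne_zero _ (by norm_num)), ← integral_eval_mul_exp _ _ s,
    ← intervalIntegral.integral_mul_const]
  congr 1
  ext θ
  set z : ℂ := (θ : ℂ) + s * I
  obtain ⟨N, rfl⟩ := Nat.exists_eq_add_of_le' hn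
  have e1 : exp (-((N + 1 + 1 : ℕ) : ℂ) * (z * I)) = exp (-z * I) ^ N * exp (-z * I) ^ 2 := by
    rw [← pow_add, ← exp_nat_mul]
    congr 1
    push_cast
    ring
  have e2 : exp ((m * h : ℝ) * (z * I)) * exp (m * (z * I)) = exp (z * I) ^ (m * (h + 1)) := by
    rw [← exp_add, ← exp_nat_mul]
    congr 1
    push_cast
    ring
  have e3 : exp ((m * h : ℝ) * (z * I)) * exp (m * (z * I)) ^ 2 =
      exp (z * I) ^ (m * (h + 2)) := by
    rw [← exp_nat_mul, ← exp_add, ← exp_nat_mul]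
    congr 1
    push_cast
    ring
  simp only [termIntegrand, termPoly, Nat.add_sub_cancel, Polynomial.eval_mul, Polynomial.eval_sub,
    Polynomial.eval_pow, Polynomial.eval_X, Polynomial.eval_one]
  rw [e1, mul_sub, e2, e3]
  calc _ = (5 * cosKernel z) ^ N * (-2 * I * sin z) ^ 2 *
        (exp (z * I) ^ (m * (h + 1)) - exp (z * I) ^ (m * (h + 2))) := by
        linear_combination (-4 * (5 * cosKernel z) ^ N * sin z ^ 2 *
          (exp (z * I) ^ (m * (h + 1)) - exp (z * I) ^ (m * (h + 2)))) * I_sq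
    _ = _ := by
        rw [← eval_kernelPoly_mul_exp, ← one_sub_exp_sq_mul_exp]
        ring

/-- The integrand for the number of all trees. -/
noncomputable def totalIntegrand (n : ℕ) (z : ℂ) : ℂ :=
  cosKernel z ^ (n - 1) * (-2 * I * sin z * (1 + exp (z * I)))

theorem integral_totalIntegrand (n : ℕ) (hn : 1 ≤ n) :
    ∫ θ in (-Real.pi)..Real.pi, totalIntegrand n (θ + (0 : ℝ) * I) =
      2 * Real.pi * (totalPoly n).coeff n / 5 ^ (n - 1) := by
  rw [eq_div_iff (pow_ne_zero _ (by norm_num)), ← integral_eval_mul_exp _ _ 0,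
    ← intervalIntegral.integral_mul_const]
  congr 1
  ext θ
  set z : ℂ := (θ : ℂ) + (0 : ℝ) * I
  obtain ⟨N, rfl⟩ := Nat.exists_eq_add_of_le' hn
  have e1 : exp (-((N + 1 : ℕ) : ℂ) * (z * I)) = exp (-z * I) ^ N * exp (-z * I) := by
    rw [← pow_succ, ← exp_nat_mul]
    congr 1
    push_cast
    ring
  simp only [totalIntegrand, totalPoly, Nat.add_sub_cancel, Polynomial.eval_mul,
    Polynomial.eval_sub, Polynomial.eval_add, Polynomial.eval_pow, Polynomial.eval_X,
    Polynomial.eval_one]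
  rw [e1, ← one_sub_exp_sq_mul_exp]
  calc _ = (5 * cosKernel z) ^ N * ((1 - exp (z * I) ^ 2) * exp (-z * I) * (1 + exp (z * I))) := by
        ring
    _ = _ := by
        rw [← eval_kernelPoly_mul_exp]
        ring

/-! ### Gaussian integrals -/

theorem integrable_pow_mul_cexp {b : ℝ} (hb : 0 < b) (k : ℕ) :
    Integrable fun θ : ℝ => (θ : ℂ) ^ k * ((Real.exp (-b * θ ^ 2) : ℝ) : ℂ) := by
  have h := (integrable_rpow_mul_exp_neg_mul_sq hb (s := k)
    (by linarith [Nat.cast_nonneg (α := ℝ) k])).ofReal (𝕜 := ℂ)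
  refine h.congr (Filter.Eventually.of_forall fun θ => ?_)
  simp

theorem hasDerivAt_cexp_neg_mul_sq (b θ : ℝ) :
    HasDerivAt (fun x : ℝ => ((Real.exp (-b * x ^ 2) : ℝ) : ℂ))
      (-2 * b * θ * ((Real.exp (-b * θ ^ 2) : ℝ) : ℂ)) θ := by
  have h := ((((hasDerivAt_pow 2 θ).const_mul (-b)).exp).ofReal_comp)
  refine h.congr_deriv ?_
  push_cast
  ring

/-- A cubic polynomial times a Gaussian. -/
theorem integral_cubic_mul_gaussian {b : ℝ} (hb : 0 < b) (c₀ c₁ c₂ c₃ : ℂ) :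
    Integrable (fun θ : ℝ => (c₀ + c₁ * θ + c₂ * θ ^ 2 + c₃ * θ ^ 3) *
      ((Real.exp (-b * θ ^ 2) : ℝ) : ℂ)) ∧
    ∫ θ : ℝ, (c₀ + c₁ * θ + c₂ * θ ^ 2 + c₃ * θ ^ 3) * ((Real.exp (-b * θ ^ 2) : ℝ) : ℂ) =
      (c₀ + c₂ / (2 * b)) * (√(Real.pi / b) : ℝ) := by
  have hI : ∀ d₀ d₁ d₂ d₃ : ℂ, Integrable (fun θ : ℝ => (d₀ + d₁ * θ + d₂ * θ ^ 2 + d₃ * θ ^ 3) *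
      ((Real.exp (-b * θ ^ 2) : ℝ) : ℂ)) := by
    intro d₀ d₁ d₂ d₃
    have h := ((((integrable_pow_mul_cexp hb 0).const_mul d₀).add
      ((integrable_pow_mul_cexp hb 1).const_mul d₁)).add
      ((integrable_pow_mul_cexp hb 2).const_mul d₂)).add
      ((integrable_pow_mul_cexp hb 3).const_mul d₃)
    refine h.congr (Filter.Eventually.of_forall fun θ => ?_)
    simp only [Pi.add_apply]
    ring
  refine ⟨hI _ _ _ _, ?_⟩
  have hb' : (b : ℂ) ≠ 0 := ofReal_ne_zero.2 hb.ne'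
  -- The primitive is found by matching coefficients of `p' - 2 b θ p`.
  have hd : ∀ θ : ℝ, HasDerivAt (fun x : ℝ => ((-(c₁ / (2 * b) + c₃ / (2 * b ^ 2)) +
      -(c₂ / (2 * b)) * x + -(c₃ / (2 * b)) * x ^ 2 + 0 * x ^ 3) *
        ((Real.exp (-b * x ^ 2) : ℝ) : ℂ) : ℂ))
      ((-(c₂ / (2 * b)) + c₁ * θ + c₂ * θ ^ 2 + c₃ * θ ^ 3) *
        ((Real.exp (-b * θ ^ 2) : ℝ) : ℂ)) θ := by
    intro θ
    have hx : HasDerivAt (fun x : ℝ => (x : ℂ)) 1 θ := by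
      simpa using (hasDerivAt_id θ).ofReal_comp
    have hp := (((hx.const_mul (-(c₂ / (2 * (b : ℂ))))).const_add
      (-(c₁ / (2 * b) + c₃ / (2 * b ^ 2)))).add ((hx.pow 2).const_mul (-(c₃ / (2 * (b : ℂ)))))).add
      ((hx.pow 3).const_mul 0)
    refine (hp.mul (hasDerivAt_cexp_neg_mul_sq b θ)).congr_deriv ?_
    simp only [Pi.add_apply, Pi.pow_apply]
    field_simp
    ring
  have h0 := integral_eq_zero_of_hasDerivAt_of_integrable hd (hI _ _ _ _) (hI _ _ _ _)
  have hg : ∫ θ : ℝ, ((Real.exp (-b * θ ^ 2) : ℝ) : ℂ) = (√(Real.pi / b) : ℝ) := by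
    rw [← integral_gaussian]
    exact integral_ofReal
  have hE : Integrable fun θ : ℝ => ((Real.exp (-b * θ ^ 2) : ℝ) : ℂ) := by
    simpa using integrable_pow_mul_cexp hb 0
  have hsplit : ∀ θ : ℝ, (c₀ + c₁ * θ + c₂ * θ ^ 2 + c₃ * θ ^ 3) *
      ((Real.exp (-b * θ ^ 2) : ℝ) : ℂ) =
      (c₀ + c₂ / (2 * b)) * ((Real.exp (-b * θ ^ 2) : ℝ) : ℂ) +
      (-(c₂ / (2 * b)) + c₁ * θ + c₂ * θ ^ 2 + c₃ * θ ^ 3) *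
        ((Real.exp (-b * θ ^ 2) : ℝ) : ℂ) := fun θ => by ring
  simp_rw [hsplit]
  rw [integral_add (hE.const_mul _) (hI _ _ _ _), h0, integral_const_mul, hg, add_zero]

/-- Comparison of an integral over `[-π, π]` with an integral over the line. -/
theorem norm_intervalIntegral_sub_integral_le {f g : ℝ → ℂ} {M : ℝ → ℝ} (hf : Continuous f)
    (hg : Integrable g) (hM : Integrable M) (h1 : ∀ θ, |θ| ≤ Real.pi → ‖f θ - g θ‖ ≤ M θ)
    (h2 : ∀ θ, Real.pi ≤ |θ| → ‖g θ‖ ≤ M θ) :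
    ‖(∫ θ in (-Real.pi)..Real.pi, f θ) - ∫ θ, g θ‖ ≤ ∫ θ, M θ := by
  have hle : -Real.pi ≤ Real.pi := by linarith [Real.pi_pos]
  have hfi : IntegrableOn f (Set.Ioc (-Real.pi) Real.pi) :=
    (hf.integrableOn_Icc).mono_set Set.Ioc_subset_Icc_self
  rw [intervalIntegral.integral_of_le hle, ← integral_indicator measurableSet_Ioc,
    ← integral_sub (hfi.integrable_indicator measurableSet_Ioc) hg]
  refine norm_integral_le_of_norm_le hM (Filter.Eventually.of_forall fun θ => ?_)
  by_cases hθ : θ ∈ Set.Ioc (-Real.pi) Real.pi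
  · rw [Set.indicator_of_mem hθ]
    exact h1 θ (abs_le.2 ⟨hθ.1.le, hθ.2⟩)
  · rw [Set.indicator_of_notMem hθ, zero_sub, norm_neg]
    refine h2 θ ?_
    rw [Set.mem_Ioc, not_and_or, not_lt, not_le] at hθ
    rcases hθ with hθ | hθ
    · exact (by linarith : Real.pi ≤ -θ).trans (neg_le_abs θ)
    · exact hθ.le.trans (le_abs_self θ)

end MultiEdgeTree

namespace MultiEdgeTree

open Complex MeasureTheory

/-! ### The contribution of a single term -/

/-- The Gaussian approximation to `termIntegrand`. -/
noncomputable def termGauss (n h m : ℕ) (z : ℂ) : ℂ :=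
  gaussKernel z ^ n * (4 * I * m * z ^ 3) * exp ((m * h : ℝ) * (z * I))

/-- First-order approximation of the factors other than the power of the kernel; the exponentials
stay bounded because `z` lies in the upper half-plane. -/
theorem exists_norm_prefactor_le : ∃ D : ℝ, 0 < D ∧ ∀ (m : ℕ) (z : ℂ), 0 ≤ z.im → ‖z‖ ≤ 6 →
    ‖-4 * sin z ^ 2 * (exp (m * (z * I)) - exp (m * (z * I)) ^ 2)‖ ≤ D * (m * ‖z‖ ^ 3) ∧
    ‖-4 * sin z ^ 2 * (exp (m * (z * I)) - exp (m * (z * I)) ^ 2) - 4 * I * m * z ^ 3‖ ≤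
      D * (m * ‖z‖ ^ 3 * (‖z‖ ^ 2 + m * ‖z‖)) := by
  obtain ⟨D₁, hD₁, h₁⟩ := exists_norm_sin_le
  obtain ⟨D₂, hD₂, h₂⟩ := exists_norm_sin_sub_le
  refine ⟨8 * D₁ ^ 2 + 28 * D₁ ^ 2 + 4 * (D₂ * (D₁ + 1)), by positivity, fun m z him hz => ?_⟩
  set w : ℂ := m * (z * I) with hw
  have hwre : w.re ≤ 0 := by
    rw [hw, ← ofReal_natCast, re_ofReal_mul, mul_I_re]
    have : (0 : ℝ) ≤ m := Nat.cast_nonneg m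
    nlinarith
  have hwn : ‖w‖ = m * ‖z‖ := by simp [hw]
  have hexp : ‖exp w‖ ≤ 1 := by rwa [norm_exp, Real.exp_le_one_iff]
  have hz0 := norm_nonneg z
  have hm0 : (0 : ℝ) ≤ m := Nat.cast_nonneg m
  have hs := h₁ z hz
  have a1 : ‖exp w - exp w ^ 2‖ ≤ 2 * (m * ‖z‖) := by
    have e : exp w - exp w ^ 2 = -(exp w * (exp w - 1)) := by ring
    rw [e, norm_neg, norm_mul, ← hwn]
    calc ‖exp w‖ * ‖exp w - 1‖ ≤ 1 * (2 * ‖w‖) := by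
          gcongr
          exact norm_exp_sub_one_le_of_re_nonpos hwre
      _ = _ := one_mul _
  have a2 : ‖exp w - exp w ^ 2 + w‖ ≤ 7 * (m * ‖z‖) ^ 2 := by
    have e : exp w - exp w ^ 2 + w = -((exp w - 1) ^ 2) - (exp w - 1 - w) := by ring
    rw [e, ← hwn]
    refine (norm_sub_le _ _).trans ?_
    rw [norm_neg, norm_pow]
    have b1 := pow_le_pow_left₀ (norm_nonneg _) (norm_exp_sub_one_le_of_re_nonpos hwre) 2
    have b2 := norm_exp_sub_one_sub_le_of_re_nonpos hwre
    linarith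
  have a3 : ‖sin z ^ 2 - z ^ 2‖ ≤ D₂ * (D₁ + 1) * ‖z‖ ^ 4 := by
    have e : sin z ^ 2 - z ^ 2 = (sin z - z) * (sin z + z) := by ring
    rw [e, norm_mul]
    calc ‖sin z - z‖ * ‖sin z + z‖ ≤ (D₂ * ‖z‖ ^ 3) * (D₁ * ‖z‖ + ‖z‖) := by
          gcongr
          · exact h₂ z hz
          · exact (norm_add_le _ _).trans (by linarith)
      _ = _ := by ring
  constructor
  · rw [norm_mul, norm_mul, norm_neg, norm_pow]
    calc ‖(4 : ℂ)‖ * ‖sin z‖ ^ 2 * ‖exp w - exp w ^ 2‖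
        ≤ 4 * (D₁ * ‖z‖) ^ 2 * (2 * (m * ‖z‖)) := by
          gcongr
          simp
      _ = 8 * D₁ ^ 2 * (m * ‖z‖ ^ 3) := by ring
      _ ≤ _ := by
          gcongr
          have : 0 ≤ 28 * D₁ ^ 2 + 4 * (D₂ * (D₁ + 1)) := by positivity
          linarith
  · have e : -4 * sin z ^ 2 * (exp w - exp w ^ 2) - 4 * I * m * z ^ 3 =
        -4 * sin z ^ 2 * (exp w - exp w ^ 2 + w) + 4 * (sin z ^ 2 - z ^ 2) * w := by
      rw [hw]
      ring
    rw [e]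
    refine (norm_add_le _ _).trans ?_
    rw [norm_mul, norm_mul, norm_mul, norm_mul, norm_neg, norm_pow, hwn]
    calc ‖(4 : ℂ)‖ * ‖sin z‖ ^ 2 * ‖exp w - exp w ^ 2 + w‖ +
          ‖(4 : ℂ)‖ * ‖sin z ^ 2 - z ^ 2‖ * (m * ‖z‖)
        ≤ 4 * (D₁ * ‖z‖) ^ 2 * (7 * (m * ‖z‖) ^ 2) +
          4 * (D₂ * (D₁ + 1) * ‖z‖ ^ 4) * (m * ‖z‖) := by
          gcongr
          · simp
          · simp
      _ = (28 * D₁ ^ 2) * (m * ‖z‖ ^ 3 * (m * ‖z‖)) +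
          (4 * (D₂ * (D₁ + 1))) * (m * ‖z‖ ^ 3 * ‖z‖ ^ 2) := by ring
      _ ≤ _ := by
          have : 0 ≤ (28 * D₁ ^ 2 + 8 * D₁ ^ 2) * (m * ‖z‖ ^ 3 * ‖z‖ ^ 2) +
            (4 * (D₂ * (D₁ + 1)) + 8 * D₁ ^ 2) * (m * ‖z‖ ^ 3 * (m * ‖z‖)) := by positivity
          linarith

theorem norm_exp_mul_mul_I (c θ s : ℝ) :
    ‖exp ((c : ℂ) * (((θ : ℂ) + s * I) * I))‖ = Real.exp (-(c * s)) := by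
  rw [norm_exp, re_ofReal_mul, mul_I_re, add_im, ofReal_im, im_ofReal_mul, I_im]
  congr 1
  ring

theorem norm_gaussKernel_pow_le (n : ℕ) (θ s : ℝ) :
    ‖gaussKernel (θ + s * I) ^ n‖ ≤ Real.exp (n * (s ^ 2 / 5 - θ ^ 2 / 500)) := by
  rw [norm_pow, Real.exp_nat_mul]
  exact pow_le_pow_left₀ (norm_nonneg _) (norm_gaussKernel_le θ s) n

/-- Pointwise error of the Gaussian approximation. Outside `[-π, π]` the Gaussian integrand itself
obeys the same bound, because `1 ≤ ‖z‖ ^ 2` there. -/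
theorem exists_norm_termIntegrand_sub_le : ∃ D : ℝ, 0 < D ∧ ∀ (n h m : ℕ) (θ s : ℝ), 2 ≤ n →
    0 ≤ s → s ≤ 5 / 2 →
    (|θ| ≤ Real.pi → ‖termIntegrand n h m (θ + s * I) - termGauss n h m (θ + s * I)‖ ≤
      D * (m * ‖(θ : ℂ) + s * I‖ ^ 3 * (n * ‖(θ : ℂ) + s * I‖ ^ 4 + ‖(θ : ℂ) + s * I‖ ^ 2 +
        m * ‖(θ : ℂ) + s * I‖)) * Real.exp (n * (s ^ 2 / 5 - θ ^ 2 / 500) - m * h * s)) ∧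
    (Real.pi ≤ |θ| → ‖termGauss n h m (θ + s * I)‖ ≤
      D * (m * ‖(θ : ℂ) + s * I‖ ^ 3 * (n * ‖(θ : ℂ) + s * I‖ ^ 4 + ‖(θ : ℂ) + s * I‖ ^ 2 +
        m * ‖(θ : ℂ) + s * I‖)) * Real.exp (n * (s ^ 2 / 5 - θ ^ 2 / 500) - m * h * s)) := by
  obtain ⟨D₁, hD₁, h₁⟩ := exists_norm_cosKernel_pow_sub_le
  obtain ⟨D₂, hD₂, h₂⟩ := exists_norm_prefactor_le
  refine ⟨(D₁ + 1) * D₂ + 4, by positivity, fun n h m θ s hn hs hs' => ?_⟩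
  have hE := norm_exp_mul_mul_I (m * h) θ s
  have hB := norm_gaussKernel_pow_le n θ s
  have hz' : 0 ≤ ((θ : ℂ) + s * I).im := by simpa using hs
  have hzθ : |θ| ≤ ‖(θ : ℂ) + s * I‖ := by simpa using abs_re_le_norm ((θ : ℂ) + s * I)
  have hpow := fun hθ => h₁ n θ s hn hθ hs hs'
  have hsix := fun hθ : |θ| ≤ Real.pi => norm_add_mul_I_le_six hθ hs hs'
  rw [sub_eq_add_neg (_ * _) (_ * _ * s), Real.exp_add, ← hE]
  set z : ℂ := (θ : ℂ) + s * I
  set E : ℂ := exp ((m * h : ℝ) * (z * I))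
  set R : ℝ := Real.exp (n * (s ^ 2 / 5 - θ ^ 2 / 500))
  have hR : 0 < R := Real.exp_pos _
  constructor
  · intro hθ
    obtain ⟨h3, h4⟩ := h₂ m z hz' (hsix hθ)
    have h5 := hpow hθ
    set S : ℂ := -4 * sin z ^ 2 * (exp (m * (z * I)) - exp (m * (z * I)) ^ 2)
    have e : termIntegrand n h m z - termGauss n h m z =
        ((cosKernel z ^ (n - 1) - gaussKernel z ^ n) * S +
          gaussKernel z ^ n * (S - 4 * I * m * z ^ 3)) * E := by
      simp only [termIntegrand, termGauss, S, E]
      ring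
    rw [e, norm_mul]
    calc ‖(cosKernel z ^ (n - 1) - gaussKernel z ^ n) * S +
          gaussKernel z ^ n * (S - 4 * I * m * z ^ 3)‖ * ‖E‖
        ≤ ((D₁ * (n * ‖z‖ ^ 4 + ‖z‖ ^ 2) * R) * (D₂ * (m * ‖z‖ ^ 3)) +
          R * (D₂ * (m * ‖z‖ ^ 3 * (‖z‖ ^ 2 + m * ‖z‖)))) * ‖E‖ := by
          gcongr
          refine (norm_add_le _ _).trans (add_le_add ?_ ?_)
          · rw [norm_mul]
            exact mul_le_mul h5 h3 (norm_nonneg _) (by positivity)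
          · rw [norm_mul]
            exact mul_le_mul hB h4 (norm_nonneg _) hR.le
      _ ≤ _ := by
          have h6 : 0 ≤ (m * ‖z‖ ^ 3 * R * ‖E‖) * (4 * (n * ‖z‖ ^ 4 + ‖z‖ ^ 2 + m * ‖z‖) +
            D₁ * D₂ * (m * ‖z‖) + D₂ * (n * ‖z‖ ^ 4)) := by positivity
          linarith
  · intro hθ
    have hz1 : 1 ≤ ‖z‖ := by linarith [Real.pi_gt_three]
    rw [termGauss, norm_mul, norm_mul]
    have e : ‖4 * I * m * z ^ 3‖ = 4 * m * ‖z‖ ^ 3 := by simp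
    rw [e]
    calc ‖gaussKernel z ^ n‖ * (4 * m * ‖z‖ ^ 3) * ‖E‖ ≤ R * (4 * m * ‖z‖ ^ 3) * ‖E‖ := by gcongr
      _ = 4 * (m * ‖z‖ ^ 3 * 1) * (R * ‖E‖) := by ring
      _ ≤ ((D₁ + 1) * D₂ + 4) * (m * ‖z‖ ^ 3 * (n * ‖z‖ ^ 4 + ‖z‖ ^ 2 + m * ‖z‖)) *
          (R * ‖E‖) := by
          have h7 : 0 ≤ (D₁ + 1) * D₂ := by positivity
          have h8 : 1 ≤ ‖z‖ ^ 2 := one_le_pow₀ hz1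
          have h9 : 0 ≤ n * ‖z‖ ^ 4 + m * ‖z‖ := by positivity
          gcongr
          · linarith
          · linarith

/-- Half of the Gaussian decay absorbs a power of `‖z‖`, rescaled by `√n`. -/
theorem exists_norm_pow_mul_exp_le (k : ℕ) : ∃ D : ℝ, 0 < D ∧ ∀ (n : ℕ) (θ s : ℝ), 1 ≤ n →
    0 ≤ s → ‖(θ : ℂ) + s * I‖ ^ k * Real.exp (-(n * (θ ^ 2 / 500))) ≤
      D * ((1 + √n * s) ^ k / √n ^ k) * Real.exp (-(n / 1000) * θ ^ 2) := by
  obtain ⟨C, hC, hb⟩ := exists_one_add_pow_mul_exp_neg_sq_le k (c := 1 / 1000) (by norm_num)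
  refine ⟨C, hC, fun n θ s hn hs => ?_⟩
  have hn0 : (0 : ℝ) < n := by exact_mod_cast hn
  have hr : 0 < √(n : ℝ) := Real.sqrt_pos.2 hn0
  have hr2 : √(n : ℝ) ^ 2 = n := Real.sq_sqrt hn0.le
  have h1 : √n * ‖(θ : ℂ) + s * I‖ ≤ (1 + √n * |θ|) * (1 + √n * s) := by
    have h2 := mul_le_mul_of_nonneg_left (norm_add_mul_I_le θ s hs) hr.le
    have h3 : 0 ≤ √n * |θ| * (√n * s) := by positivity
    linarith
  have h2 := hb (√n * |θ|) (by positivity)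
  have e1 : -(1 / 1000) * (√n * |θ|) ^ 2 = -(n / 1000) * θ ^ 2 := by
    rw [mul_pow, hr2, sq_abs]
    ring
  rw [e1] at h2
  have e2 : Real.exp (-(n * (θ ^ 2 / 500))) =
      Real.exp (-(n / 1000) * θ ^ 2) * Real.exp (-(n / 1000) * θ ^ 2) := by
    rw [← Real.exp_add]
    congr 1
    ring
  have h3 : ‖(θ : ℂ) + s * I‖ ^ k ≤ (1 + √n * |θ|) ^ k * ((1 + √n * s) ^ k / √n ^ k) := by
    rw [← mul_div_assoc, le_div_iff₀ (by positivity), ← mul_pow, ← mul_pow, mul_comm]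
    exact pow_le_pow_left₀ (by positivity) h1 k
  rw [e2]
  calc _ ≤ (1 + √n * |θ|) ^ k * ((1 + √n * s) ^ k / √n ^ k) *
        (Real.exp (-(n / 1000) * θ ^ 2) * Real.exp (-(n / 1000) * θ ^ 2)) := by gcongr
    _ = ((1 + √n * |θ|) ^ k * Real.exp (-(n / 1000) * θ ^ 2)) * ((1 + √n * s) ^ k / √n ^ k) *
        Real.exp (-(n / 1000) * θ ^ 2) := by ring
    _ ≤ _ := by gcongr

/-- Integrable majorant for the error of the Gaussian approximation. -/
theorem exists_termMajorant_le : ∃ D : ℝ, 0 < D ∧ ∀ (n m : ℕ) (θ s : ℝ), 1 ≤ n → 0 ≤ s →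
    ‖(θ : ℂ) + s * I‖ ^ 3 * (n * ‖(θ : ℂ) + s * I‖ ^ 4 + ‖(θ : ℂ) + s * I‖ ^ 2 +
      m * ‖(θ : ℂ) + s * I‖) * Real.exp (-(n * (θ ^ 2 / 500))) ≤
    D * (((1 + √n * s) ^ 7 / n + m * (1 + √n * s) ^ 4 / √n) / √n ^ 3) *
      Real.exp (-(n / 1000) * θ ^ 2) := by
  obtain ⟨D₇, hD₇, h₇⟩ := exists_norm_pow_mul_exp_le 7
  obtain ⟨D₅, hD₅, h₅⟩ := exists_norm_pow_mul_exp_le 5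
  obtain ⟨D₄, hD₄, h₄⟩ := exists_norm_pow_mul_exp_le 4
  refine ⟨D₇ + D₅ + D₄, by positivity, fun n m θ s hn hs => ?_⟩
  have a7 := h₇ n θ s hn hs
  have a5 := h₅ n θ s hn hs
  have a4 := h₄ n θ s hn hs
  have hn0 : (0 : ℝ) < n := by exact_mod_cast hn
  have hr2 : √(n : ℝ) ^ 2 = n := Real.sq_sqrt hn0.le
  have hr : 0 < √(n : ℝ) := Real.sqrt_pos.2 hn0
  set r := √(n : ℝ)
  set x := ‖(θ : ℂ) + s * I‖
  set R := Real.exp (-(n * (θ ^ 2 / 500)))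
  set R' := Real.exp (-(n / 1000) * θ ^ 2)
  have hR' : 0 < R' := Real.exp_pos _
  rw [← hr2]
  have b5 : (1 + r * s) ^ 5 ≤ (1 + r * s) ^ 7 :=
    pow_le_pow_right₀ (by linarith [mul_nonneg hr.le hs]) (by norm_num)
  have b5' : x ^ 5 * R ≤ D₅ * ((1 + r * s) ^ 7 / r ^ 5) * R' := a5.trans (by gcongr)
  calc x ^ 3 * (r ^ 2 * x ^ 4 + x ^ 2 + m * x) * R
      = r ^ 2 * (x ^ 7 * R) + x ^ 5 * R + m * (x ^ 4 * R) := by ring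
    _ ≤ r ^ 2 * (D₇ * ((1 + r * s) ^ 7 / r ^ 7) * R') + D₅ * ((1 + r * s) ^ 7 / r ^ 5) * R' +
        m * (D₄ * ((1 + r * s) ^ 4 / r ^ 4) * R') := by
        gcongr
    _ = (D₇ * ((1 + r * s) ^ 7 / r ^ 2) + D₅ * ((1 + r * s) ^ 7 / r ^ 2) +
        D₄ * (m * (1 + r * s) ^ 4 / r)) / r ^ 3 * R' := by
        field_simp
    _ ≤ ((D₇ + D₅ + D₄) * ((1 + r * s) ^ 7 / r ^ 2 + m * (1 + r * s) ^ 4 / r)) / r ^ 3 * R' := by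
        gcongr
        have : 0 ≤ D₄ * ((1 + r * s) ^ 7 / r ^ 2) + (D₇ + D₅) * (m * (1 + r * s) ^ 4 / r) := by
          positivity
        linarith
    _ = _ := by ring

/-- At the saddle point `s = 5 m h / (2 n)` the linear terms in the exponent cancel. -/
theorem termGauss_saddle (n h m : ℕ) (hn : 1 ≤ n) {s : ℝ} (hs : s = 5 * (m * h) / (2 * n)) (θ : ℝ) :
    termGauss n h m (θ + s * I) =
      ((4 * m * s ^ 3 : ℂ) * (Real.exp (-(5 * (m * h) ^ 2 / (4 * n))) : ℝ) +
        (-(12 * I * m * s ^ 2) * (Real.exp (-(5 * (m * h) ^ 2 / (4 * n))) : ℝ)) * θ +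
        (-(12 * m * s) * (Real.exp (-(5 * (m * h) ^ 2 / (4 * n))) : ℝ)) * θ ^ 2 +
        (4 * I * m * (Real.exp (-(5 * (m * h) ^ 2 / (4 * n))) : ℝ)) * θ ^ 3) *
        ((Real.exp (-(n / 5 : ℝ) * θ ^ 2) : ℝ) : ℂ) := by
  have hn0 : (n : ℂ) ≠ 0 := by
    have : n ≠ 0 := by omega
    exact_mod_cast this
  have e1 : gaussKernel (θ + s * I) ^ n * exp ((m * h : ℝ) * ((θ + s * I) * I)) =
      (Real.exp (-(5 * (m * h) ^ 2 / (4 * n))) : ℝ) *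
        ((Real.exp (-(n / 5 : ℝ) * θ ^ 2) : ℝ) : ℂ) := by
    rw [gaussKernel, ← exp_nat_mul, ← exp_add, ofReal_exp, ofReal_exp, ← exp_add]
    congr 1
    rw [hs]
    push_cast
    field_simp
    ring_nf
    simp only [I_sq]
    ring
  calc termGauss n h m (θ + s * I) = (4 * I * m * (θ + s * I) ^ 3) *
        (gaussKernel (θ + s * I) ^ n * exp ((m * h : ℝ) * ((θ + s * I) * I))) := by
        rw [termGauss]
        ring
    _ = (4 * m * s ^ 3 + -(12 * I * m * s ^ 2) * θ + -(12 * m * s) * θ ^ 2 +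
        4 * I * m * θ ^ 3) * (gaussKernel (θ + s * I) ^ n *
          exp ((m * h : ℝ) * ((θ + s * I) * I))) := by
        congr 1
        linear_combination (12 * m * θ ^ 2 * s + 12 * m * θ * s ^ 2 * I +
          4 * m * s ^ 3 * (I ^ 2 - 1)) * I_sq
    _ = _ := by
        rw [e1]
        ring

end MultiEdgeTree

namespace MultiEdgeTree

open Complex MeasureTheory

/-- The argument `√5 h / (2 √n)` of the limit function. -/
noncomputable def scaledHeight (n h : ℕ) : ℝ := √5 * h / (2 * √n)

theorem scaledHeight_pos {n h : ℕ} (hn : 1 ≤ n) (hh : 1 ≤ h) : 0 < scaledHeight n h := by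
  have : (0 : ℝ) < n := by exact_mod_cast hn
  have : (0 : ℝ) < h := by exact_mod_cast hh
  unfold scaledHeight
  positivity

theorem scaledHeight_sq (n h : ℕ) : scaledHeight n h ^ 2 = 5 * h ^ 2 / (4 * n) := by
  rw [scaledHeight, div_pow, mul_pow, mul_pow, Real.sq_sqrt (by norm_num),
    Real.sq_sqrt (Nat.cast_nonneg n)]
  norm_num

/-- The `m`-th term of the series `G α`. -/
noncomputable def limitTerm (α : ℝ) (m : ℕ) : ℝ :=
  (2 * α ^ 2 * (m : ℝ) ^ 2 - 3) * (m : ℝ) ^ 2 * Real.exp (-α ^ 2 * (m : ℝ) ^ 2)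

theorem integral_termGauss (n h m : ℕ) (hn : 1 ≤ n) {s : ℝ} (hs : s = 5 * (m * h) / (2 * n)) :
    Integrable (fun θ : ℝ => termGauss n h m (θ + s * I)) ∧
    ∫ θ : ℝ, termGauss n h m (θ + s * I) =
      ((√(5 * Real.pi / n) * (25 * h / n ^ 2) * limitTerm (scaledHeight n h) m : ℝ) : ℂ) := by
  have hn0 : (0 : ℝ) < n := by exact_mod_cast hn
  have hn0' : (n : ℂ) ≠ 0 := by exact_mod_cast hn0.ne'
  simp_rw [termGauss_saddle n h m hn hs]
  obtain ⟨h1, h2⟩ := integral_cubic_mul_gaussian (b := n / 5) (by positivity)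
    ((4 * m * s ^ 3 : ℂ) * (Real.exp (-(5 * (m * h) ^ 2 / (4 * n))) : ℝ))
    (-(12 * I * m * s ^ 2) * (Real.exp (-(5 * (m * h) ^ 2 / (4 * n))) : ℝ))
    (-(12 * m * s) * (Real.exp (-(5 * (m * h) ^ 2 / (4 * n))) : ℝ))
    (4 * I * m * (Real.exp (-(5 * (m * h) ^ 2 / (4 * n))) : ℝ))
  refine ⟨h1, h2.trans ?_⟩
  have e1 : Real.pi / (n / 5) = 5 * Real.pi / n := by field_simp
  have e2 : -scaledHeight n h ^ 2 * (m : ℝ) ^ 2 = -(5 * (m * h) ^ 2 / (4 * n)) := by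
    rw [scaledHeight_sq]
    field_simp
  rw [e1, limitTerm, e2, scaledHeight_sq, hs]
  generalize √(5 * Real.pi / n) = K
  generalize Real.exp (-(5 * (m * h) ^ 2 / (4 * n))) = E
  push_cast
  field_simp
  ring

theorem sqrt_pi_div_le (n : ℕ) : √(Real.pi / (n / 1000)) ≤ 15 * √(5 * Real.pi / n) := by
  rw [show (15 : ℝ) = √(15 ^ 2) by rw [Real.sqrt_sq (by norm_num)], ← Real.sqrt_mul (by norm_num)]
  refine Real.sqrt_le_sqrt ?_
  have h : 0 ≤ Real.pi / n := by positivity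
  have e1 : Real.pi / (n / 1000 : ℝ) = 1000 * (Real.pi / n) := by rw [div_div_eq_mul_div]; ring
  have e2 : (15 : ℝ) ^ 2 * (5 * Real.pi / n) = 1125 * (Real.pi / n) := by ring
  rw [e1, e2]
  linarith

/-- The exact term of the count, compared with the term of `G`, when the saddle point stays in a
bounded region. -/
theorem exists_norm_coeff_termPoly_sub_le_of_le : ∃ D : ℝ, 0 < D ∧ ∀ (n h : ℕ) (m : ℕ+), 2 ≤ n →
    1 ≤ h → (m : ℕ) * h ≤ n →
    ‖2 * Real.pi * (termPoly n h m).coeff (n + 1) / 5 ^ (n - 1) -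
      ((√(5 * Real.pi / n) * (25 * h / n ^ 2) * limitTerm (scaledHeight n h) m : ℝ) : ℂ)‖ ≤
    D * (√(5 * Real.pi / n) * (h / n ^ 2) * termError n (scaledHeight n h) m) := by
  obtain ⟨D₁, hD₁, h₁⟩ := exists_norm_termIntegrand_sub_le
  obtain ⟨D₂, hD₂, h₂⟩ := exists_termMajorant_le
  refine ⟨D₁ * D₂ * 15 * (√5 / 2), by positivity, fun n h m hn hh hmh => ?_⟩
  have hn1 : 1 ≤ n := by omega
  have hn0 : (0 : ℝ) < n := by exact_mod_cast hn1
  have hh0 : (0 : ℝ) < h := by exact_mod_cast hh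
  have hα := scaledHeight_pos hn1 hh
  have hmh' : (m : ℝ) * h ≤ n := by exact_mod_cast hmh
  set s : ℝ := 5 * (m * h) / (2 * n) with hs
  have hs0 : 0 ≤ s := by positivity
  have hs1 : s ≤ 5 / 2 := by
    rw [hs, div_le_div_iff₀ (by positivity) (by norm_num)]
    linarith
  obtain ⟨hint, hval⟩ := integral_termGauss n h m hn1 hs
  have hr : 0 < √(n : ℝ) := Real.sqrt_pos.2 hn0
  have hr2 : √(n : ℝ) ^ 2 = n := Real.sq_sqrt hn0.le
  set P : ℝ := ((1 + √n * s) ^ 7 / n + m * (1 + √n * s) ^ 4 / √n) / √n ^ 3 with hP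
  have hP0 : 0 ≤ P := by positivity
  set E : ℝ := Real.exp (-scaledHeight n h ^ 2 * (m : ℝ) ^ 2) with hE
  have hE0 : 0 < E := Real.exp_pos _
  have hexp : ∀ θ : ℝ, Real.exp (n * (s ^ 2 / 5 - θ ^ 2 / 500) - m * h * s) =
      E * Real.exp (-(n * (θ ^ 2 / 500))) := by
    intro θ
    rw [hE, ← Real.exp_add, scaledHeight_sq, hs]
    congr 1
    field_simp
    ring
  have hmaj : ∀ θ : ℝ, D₁ * (m * ‖(θ : ℂ) + s * I‖ ^ 3 * (n * ‖(θ : ℂ) + s * I‖ ^ 4 +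
      ‖(θ : ℂ) + s * I‖ ^ 2 + m * ‖(θ : ℂ) + s * I‖)) *
        Real.exp (n * (s ^ 2 / 5 - θ ^ 2 / 500) - m * h * s) ≤
      D₁ * m * E * (D₂ * P) * Real.exp (-(n / 1000) * θ ^ 2) := by
    intro θ
    rw [hexp]
    have h3 := mul_le_mul_of_nonneg_left (h₂ n m θ s hn1 hs0)
      (by positivity : 0 ≤ D₁ * m * E)
    calc _ = D₁ * m * E * (‖(θ : ℂ) + s * I‖ ^ 3 * (n * ‖(θ : ℂ) + s * I‖ ^ 4 +
          ‖(θ : ℂ) + s * I‖ ^ 2 + m * ‖(θ : ℂ) + s * I‖) *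
            Real.exp (-(n * (θ ^ 2 / 500)))) := by ring
      _ ≤ _ := h3
      _ = _ := by rw [← hP]; ring
  have hcont : Continuous fun θ : ℝ => termIntegrand n h m (θ + s * I) := by
    unfold termIntegrand cosKernel
    fun_prop
  have hM : Integrable fun θ : ℝ => D₁ * m * E * (D₂ * P) * Real.exp (-(n / 1000) * θ ^ 2) :=
    (integrable_exp_neg_mul_sq (by positivity)).const_mul _
  have key := norm_intervalIntegral_sub_integral_le hcont hint hM
    (fun θ hθ => ((h₁ n h m θ s hn hs0 hs1).1 hθ).trans (hmaj θ))
    (fun θ hθ => ((h₁ n h m θ s hn hs0 hs1).2 hθ).trans (hmaj θ))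
  rw [integral_termIntegrand n h m hn1, hval, integral_const_mul, integral_gaussian] at key
  refine key.trans ?_
  have hy : √n * s = √5 * scaledHeight n h * m := by
    rw [hs, scaledHeight, ← hr2]
    have h5 : √(5 : ℝ) ^ 2 = 5 := Real.sq_sqrt (by norm_num)
    rw [Real.sqrt_sq hr.le]
    field_simp
    linear_combination -h5
  have hfin : m * E * P = √5 / 2 * (h / n ^ 2 * termError n (scaledHeight n h) m) := by
    rw [termError, ← hE, hP, ← hy]
    have e1 : 1 / scaledHeight n h = 2 * √n / (√5 * h) := by rw [scaledHeight, one_div_div]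
    rw [e1]
    generalize (1 + √n * s) = Y
    have e3 : (n : ℝ) ^ 2 = √n ^ 3 * √n := by
      rw [← hr2, Real.sqrt_sq hr.le]
      ring
    rw [e3]
    field_simp
  calc D₁ * m * E * (D₂ * P) * √(Real.pi / (n / 1000))
      ≤ D₁ * m * E * (D₂ * P) * (15 * √(5 * Real.pi / n)) := by
        gcongr
        exact sqrt_pi_div_le n
    _ = D₁ * D₂ * 15 * √(5 * Real.pi / n) * (m * E * P) := by ring
    _ = _ := by
        rw [hfin]
        ring

/-- For `m (h + 1) > n + 1` the exact term vanishes, and the term of `G` is itself of the size of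
the error. -/
theorem norm_coeff_termPoly_sub_le_of_lt (n h : ℕ) (m : ℕ+) (hn : 2 ≤ n) (hh : 1 ≤ h)
    (hm : n + 1 < (m : ℕ) * (h + 1)) :
    ‖2 * Real.pi * (termPoly n h m).coeff (n + 1) / 5 ^ (n - 1) -
      ((√(5 * Real.pi / n) * (25 * h / n ^ 2) * limitTerm (scaledHeight n h) m : ℝ) : ℂ)‖ ≤
    75 * (√(5 * Real.pi / n) * (h / n ^ 2) * termError n (scaledHeight n h) m) := by
  have hn1 : 1 ≤ n := by omega
  have hn0 : (0 : ℝ) < n := by exact_mod_cast hn1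
  have hh0 : (0 : ℝ) < h := by exact_mod_cast hh
  have hα := scaledHeight_pos hn1 hh
  have hr : 0 < √(n : ℝ) := Real.sqrt_pos.2 hn0
  have hr2 : √(n : ℝ) ^ 2 = n := Real.sq_sqrt hn0.le
  rw [coeff_termPoly_eq_zero hm, mul_zero, zero_div, zero_sub, norm_neg, norm_real,
    Real.norm_eq_abs, abs_mul,
    abs_of_nonneg (by positivity)]
  have hm2 : (n : ℝ) ≤ 2 * (m * h) := by
    have h1 : n ≤ 2 * ((m : ℕ) * h) := by
      have := Nat.mul_le_mul_left (m : ℕ) hh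
      rw [mul_add] at hm
      omega
    exact_mod_cast h1
  have hm1 : (1 : ℝ) ≤ m := Nat.one_le_cast.2 m.pos
  set α := scaledHeight n h with hαdef
  set x : ℝ := α * m with hx
  have hx0 : 0 < x := by positivity
  set y : ℝ := √5 * α * m with hy
  have h5 : √(5 : ℝ) ^ 2 = 5 := Real.sq_sqrt (by norm_num)
  have hxy : x ≤ y := by
    have : 1 ≤ √(5 : ℝ) := by
      rw [Real.one_le_sqrt]
      norm_num
    rw [hy, mul_assoc]
    exact le_mul_of_one_le_left hx0.le this
  have hyn : (n : ℝ) ≤ y ^ 2 := by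
    have e : y ^ 2 = 25 * (m * h) ^ 2 / (4 * n) := by
      rw [hy, mul_pow, mul_pow, h5, hαdef, scaledHeight_sq]
      ring
    rw [e, le_div_iff₀ (by positivity)]
    nlinarith
  have hy0 : 0 ≤ y := by positivity
  have hpoly : n * (x * (2 * x ^ 2 + 3)) ≤ 3 * (1 + y) ^ 7 := by
    calc n * (x * (2 * x ^ 2 + 3)) ≤ (1 + y) ^ 2 * ((1 + y) * (3 * (1 + y) ^ 2)) := by
          gcongr
          · nlinarith
          · linarith
          · nlinarith
      _ = 3 * (1 + y) ^ 5 := by ring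
      _ ≤ 3 * (1 + y) ^ 7 := by
          gcongr
          · linarith
          · norm_num
  have hE : 0 < Real.exp (-α ^ 2 * (m : ℝ) ^ 2) := Real.exp_pos _
  have hterm : |limitTerm α m| ≤ 3 * termError n α m := by
    have h1 : |limitTerm α m| ≤
        (2 * x ^ 2 + 3) * (m : ℝ) ^ 2 * Real.exp (-α ^ 2 * (m : ℝ) ^ 2) := by
      rw [limitTerm, abs_mul, abs_mul, abs_of_pos hE, abs_of_nonneg (sq_nonneg (m : ℝ))]
      gcongr
      rw [abs_le]
      constructor <;> nlinarith [sq_nonneg x]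
    refine h1.trans ?_
    have h2 : (2 * x ^ 2 + 3) * (m : ℝ) ^ 2 ≤ 3 * (1 / α * (m * (1 + y) ^ 7 / n)) := by
      have e : 3 * (1 / α * ((m : ℝ) * (1 + y) ^ 7 / n)) = (3 * (1 + y) ^ 7) * (m / (α * n)) := by
        field_simp
      rw [e]
      calc (2 * x ^ 2 + 3) * (m : ℝ) ^ 2 = (n * (x * (2 * x ^ 2 + 3))) * (m / (α * n)) := by
            rw [hx]
            field_simp
        _ ≤ _ := by gcongr
    rw [termError, ← hy]
    calc _ ≤ 3 * (1 / α * (m * (1 + y) ^ 7 / n)) * Real.exp (-α ^ 2 * (m : ℝ) ^ 2) := by gcongr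
      _ = 3 * (1 / α * Real.exp (-α ^ 2 * (m : ℝ) ^ 2) * (m * (1 + y) ^ 7 / n)) := by ring
      _ ≤ _ := by
          gcongr
          exact le_add_of_nonneg_right (by positivity)
  calc √(5 * Real.pi / n) * (25 * h / n ^ 2) * |limitTerm α m|
      ≤ √(5 * Real.pi / n) * (25 * h / n ^ 2) * (3 * termError n α m) := by gcongr
    _ = _ := by ring

theorem exists_norm_coeff_termPoly_sub_le : ∃ D : ℝ, 0 < D ∧ ∀ (n h : ℕ) (m : ℕ+), 2 ≤ n →
    1 ≤ h →
    ‖2 * Real.pi * (termPoly n h m).coeff (n + 1) / 5 ^ (n - 1) -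
      ((√(5 * Real.pi / n) * (25 * h / n ^ 2) * limitTerm (scaledHeight n h) m : ℝ) : ℂ)‖ ≤
    D * (√(5 * Real.pi / n) * (h / n ^ 2) * termError n (scaledHeight n h) m) := by
  obtain ⟨D, hD, hle⟩ := exists_norm_coeff_termPoly_sub_le_of_le
  refine ⟨D + 75, by positivity, fun n h m hn hh => ?_⟩
  have h0 : 0 ≤ √(5 * Real.pi / n) * (h / n ^ 2) * termError n (scaledHeight n h) m :=
    mul_nonneg (by positivity) (termError_nonneg n (scaledHeight_pos (by omega) hh) m)
  by_cases hm : n + 1 < (m : ℕ) * (h + 1)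
  · exact (norm_coeff_termPoly_sub_le_of_lt n h m hn hh hm).trans (by gcongr; linarith)
  · have hmh : (m : ℕ) * h ≤ n := by
      have := m.pos
      rw [mul_add] at hm
      omega
    exact (hle n h m hn hh hmh).trans (by gcongr; linarith)

/-! ### The number of all trees -/

theorem exists_norm_total_prefactor_le : ∃ D : ℝ, 0 < D ∧ ∀ z : ℂ, 0 ≤ z.im → ‖z‖ ≤ 6 →
    ‖-2 * I * sin z * (1 + exp (z * I))‖ ≤ D * ‖z‖ ∧
    ‖-2 * I * sin z * (1 + exp (z * I)) - (-4 * I * z + 2 * z ^ 2)‖ ≤ D * ‖z‖ ^ 3 := by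
  obtain ⟨D₁, hD₁, h₁⟩ := exists_norm_sin_le
  obtain ⟨D₂, hD₂, h₂⟩ := exists_norm_sin_sub_le
  refine ⟨4 * D₁ + 4 * D₂ + 6, by positivity, fun z him hz => ?_⟩
  have hre : (z * I).re ≤ 0 := by simpa using him
  have hwn : ‖z * I‖ = ‖z‖ := by simp
  have hexp : ‖exp (z * I)‖ ≤ 1 := by rwa [norm_exp, Real.exp_le_one_iff]
  have h1e : ‖1 + exp (z * I)‖ ≤ 2 := (norm_add_le _ _).trans (by rw [norm_one]; linarith)
  have h3 := norm_exp_sub_one_sub_le_of_re_nonpos hre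
  rw [hwn] at h3
  have hz0 := norm_nonneg z
  have h2I : ‖-2 * I‖ = 2 := by simp
  constructor
  · rw [norm_mul, norm_mul, h2I]
    calc 2 * ‖sin z‖ * ‖1 + exp (z * I)‖ ≤ 2 * (D₁ * ‖z‖) * 2 := by
          gcongr
          exact h₁ z hz
      _ ≤ _ := by nlinarith
  · have e : -2 * I * sin z * (1 + exp (z * I)) - (-4 * I * z + 2 * z ^ 2) =
        -2 * I * (sin z - z) * (1 + exp (z * I)) + -2 * I * z * (exp (z * I) - 1 - z * I) := by
      linear_combination (-2 * z ^ 2) * I_sq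
    rw [e]
    refine (norm_add_le _ _).trans ?_
    rw [norm_mul, norm_mul, norm_mul (-2 * I * z), norm_mul _ z, h2I]
    calc 2 * ‖sin z - z‖ * ‖1 + exp (z * I)‖ + 2 * ‖z‖ * ‖exp (z * I) - 1 - z * I‖
        ≤ 2 * (D₂ * ‖z‖ ^ 3) * 2 + 2 * ‖z‖ * (3 * ‖z‖ ^ 2) := by
          gcongr
          exact h₂ z hz
      _ ≤ _ := by nlinarith [pow_nonneg hz0 3]

theorem exists_norm_coeff_totalPoly_sub_le : ∃ D : ℝ, 0 < D ∧ ∀ n : ℕ, 2 ≤ n →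
    ‖2 * Real.pi * (totalPoly n).coeff n / 5 ^ (n - 1) -
      ((√(5 * Real.pi / n) * (5 / n) : ℝ) : ℂ)‖ ≤ D * (√(5 * Real.pi / n) * (5 / n) / √n) := by
  obtain ⟨D₁, hD₁, h₁⟩ := exists_norm_cosKernel_pow_sub_le
  obtain ⟨D₂, hD₂, h₂⟩ := exists_norm_total_prefactor_le
  obtain ⟨D₅, hD₅, h₅⟩ := exists_norm_pow_mul_exp_le 5
  obtain ⟨D₃, hD₃, h₃⟩ := exists_norm_pow_mul_exp_le 3
  set K : ℝ := (D₁ + 1) * D₂ + 6 with hK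
  have hK0 : 0 < K := by positivity
  refine ⟨K * (D₅ + D₃) * 3, by positivity, fun n hn => ?_⟩
  have hn1 : 1 ≤ n := by omega
  have hn0 : (0 : ℝ) < n := by exact_mod_cast hn1
  have hr : 0 < √(n : ℝ) := Real.sqrt_pos.2 hn0
  have hr2 : √(n : ℝ) ^ 2 = n := Real.sq_sqrt hn0.le
  have hgauss : ∀ θ : ℝ, gaussKernel (θ + (0 : ℝ) * I) ^ n *
      (-4 * I * (θ + (0 : ℝ) * I) + 2 * (θ + (0 : ℝ) * I) ^ 2) =
      (0 + (-4 * I) * θ + 2 * θ ^ 2 + 0 * θ ^ 3) *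
        ((Real.exp (-(n / 5 : ℝ) * θ ^ 2) : ℝ) : ℂ) := by
    intro θ
    have e : gaussKernel (θ + (0 : ℝ) * I) ^ n = ((Real.exp (-(n / 5 : ℝ) * θ ^ 2) : ℝ) : ℂ) := by
      rw [gaussKernel, ← exp_nat_mul, ofReal_exp]
      congr 1
      push_cast
      ring
    rw [e, ofReal_zero]
    ring
  obtain ⟨hint, hval⟩ := integral_cubic_mul_gaussian (b := n / 5) (by positivity) 0 (-4 * I) 2 0
  simp_rw [← hgauss] at hint hval
  have e1 : Real.pi / (n / 5) = 5 * Real.pi / n := by field_simp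
  have e2 : (0 + 2 / (2 * ((n / 5 : ℝ) : ℂ))) * (√(Real.pi / (n / 5)) : ℝ) =
      ((√(5 * Real.pi / n) * (5 / n) : ℝ) : ℂ) := by
    have hn0' : (n : ℂ) ≠ 0 := by exact_mod_cast hn0.ne'
    rw [e1]
    push_cast
    field_simp
    ring
  rw [e2] at hval
  have hpt : ∀ θ : ℝ,
      (|θ| ≤ Real.pi → ‖totalIntegrand n (θ + (0 : ℝ) * I) - gaussKernel (θ + (0 : ℝ) * I) ^ n *
        (-4 * I * (θ + (0 : ℝ) * I) + 2 * (θ + (0 : ℝ) * I) ^ 2)‖ ≤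
        K * (n * ‖(θ : ℂ) + (0 : ℝ) * I‖ ^ 5 + ‖(θ : ℂ) + (0 : ℝ) * I‖ ^ 3) *
          Real.exp (-(n * (θ ^ 2 / 500)))) ∧
      (Real.pi ≤ |θ| → ‖gaussKernel (θ + (0 : ℝ) * I) ^ n *
        (-4 * I * (θ + (0 : ℝ) * I) + 2 * (θ + (0 : ℝ) * I) ^ 2)‖ ≤
        K * (n * ‖(θ : ℂ) + (0 : ℝ) * I‖ ^ 5 + ‖(θ : ℂ) + (0 : ℝ) * I‖ ^ 3) *
          Real.exp (-(n * (θ ^ 2 / 500)))) := by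
    intro θ
    have hB := norm_gaussKernel_pow_le n θ 0
    have hz' : 0 ≤ ((θ : ℂ) + (0 : ℝ) * I).im := by simp
    have hzθ : |θ| ≤ ‖(θ : ℂ) + (0 : ℝ) * I‖ := by
      simp
    have hpow := fun hθ => h₁ n θ 0 hn hθ le_rfl (by norm_num)
    have hsix := fun hθ : |θ| ≤ Real.pi =>
      norm_add_mul_I_le_six (s := 0) hθ le_rfl (by norm_num)
    have e : (n : ℝ) * (0 ^ 2 / 5 - θ ^ 2 / 500) = -(n * (θ ^ 2 / 500)) := by ring
    rw [e] at hB hpow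
    set z : ℂ := (θ : ℂ) + (0 : ℝ) * I
    set R : ℝ := Real.exp (-(n * (θ ^ 2 / 500)))
    have hR : 0 < R := Real.exp_pos _
    constructor
    · intro hθ
      obtain ⟨h3, h4⟩ := h₂ z hz' (hsix hθ)
      have h5 := hpow hθ
      set S : ℂ := -2 * I * sin z * (1 + exp (z * I))
      have e : totalIntegrand n z - gaussKernel z ^ n * (-4 * I * z + 2 * z ^ 2) =
          (cosKernel z ^ (n - 1) - gaussKernel z ^ n) * S +
            gaussKernel z ^ n * (S - (-4 * I * z + 2 * z ^ 2)) := by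
        simp only [totalIntegrand, S]
        ring
      rw [e]
      calc _ ≤ (D₁ * (n * ‖z‖ ^ 4 + ‖z‖ ^ 2) * R) * (D₂ * ‖z‖) + R * (D₂ * ‖z‖ ^ 3) := by
            refine (norm_add_le _ _).trans (add_le_add ?_ ?_)
            · rw [norm_mul]
              exact mul_le_mul h5 h3 (norm_nonneg _) (by positivity)
            · rw [norm_mul]
              exact mul_le_mul hB h4 (norm_nonneg _) hR.le
        _ ≤ _ := by
            have h6 : 0 ≤ R * (6 * (n * ‖z‖ ^ 5 + ‖z‖ ^ 3) + D₂ * (n * ‖z‖ ^ 5)) := by positivity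
            rw [hK]
            linarith
    · intro hθ
      have hz1 : 1 ≤ ‖z‖ := by linarith [Real.pi_gt_three]
      have h7 : ‖-4 * I * z + 2 * z ^ 2‖ ≤ 6 * ‖z‖ ^ 3 := by
        refine (norm_add_le _ _).trans ?_
        have a1 : ‖-4 * I * z‖ = 4 * ‖z‖ := by simp
        have a2 : ‖2 * z ^ 2‖ = 2 * ‖z‖ ^ 2 := by simp
        have a3 : ‖z‖ ≤ ‖z‖ ^ 3 := le_self_pow₀ hz1 (by norm_num)
        have a4 : ‖z‖ ^ 2 ≤ ‖z‖ ^ 3 := pow_le_pow_right₀ hz1 (by norm_num)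
        rw [a1, a2]
        linarith
      rw [norm_mul]
      calc _ ≤ R * (6 * ‖z‖ ^ 3) := mul_le_mul hB h7 (norm_nonneg _) hR.le
        _ ≤ _ := by
            have h6 : 0 ≤ R * ((D₁ + 1) * D₂ * (n * ‖z‖ ^ 5 + ‖z‖ ^ 3) + 6 * (n * ‖z‖ ^ 5)) := by
              positivity
            rw [hK]
            linarith
  have hmaj : ∀ θ : ℝ, K * (n * ‖(θ : ℂ) + (0 : ℝ) * I‖ ^ 5 + ‖(θ : ℂ) + (0 : ℝ) * I‖ ^ 3) *
      Real.exp (-(n * (θ ^ 2 / 500))) ≤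
      K * (D₅ + D₃) / √n ^ 3 * Real.exp (-(n / 1000) * θ ^ 2) := by
    intro θ
    have a5 := h₅ n θ 0 hn1 le_rfl
    have a3 := h₃ n θ 0 hn1 le_rfl
    rw [mul_zero, add_zero, one_pow] at a5 a3
    set x := ‖(θ : ℂ) + (0 : ℝ) * I‖
    set R := Real.exp (-(n * (θ ^ 2 / 500)))
    set R' := Real.exp (-(n / 1000) * θ ^ 2)
    calc K * (n * x ^ 5 + x ^ 3) * R = K * (n * (x ^ 5 * R) + x ^ 3 * R) := by ring
      _ ≤ K * (n * (D₅ * (1 / √n ^ 5) * R') + D₃ * (1 / √n ^ 3) * R') := by gcongr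
      _ = K * (√n ^ 2 * (D₅ * (1 / √n ^ 5) * R') + D₃ * (1 / √n ^ 3) * R') := by rw [hr2]
      _ = _ := by field_simp
  have hcont : Continuous fun θ : ℝ => totalIntegrand n (θ + (0 : ℝ) * I) := by
    unfold totalIntegrand cosKernel
    fun_prop
  have hM : Integrable fun θ : ℝ =>
      K * (D₅ + D₃) / √n ^ 3 * Real.exp (-(n / 1000) * θ ^ 2) :=
    (integrable_exp_neg_mul_sq (by positivity)).const_mul _
  have key := norm_intervalIntegral_sub_integral_le hcont hint hM
    (fun θ hθ => ((hpt θ).1 hθ).trans (hmaj θ)) (fun θ hθ => ((hpt θ).2 hθ).trans (hmaj θ))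
  rw [integral_totalIntegrand n hn1, hval, integral_const_mul, integral_gaussian] at key
  refine key.trans ?_
  calc K * (D₅ + D₃) / √n ^ 3 * √(Real.pi / (n / 1000))
      ≤ K * (D₅ + D₃) / √n ^ 3 * (15 * √(5 * Real.pi / n)) := by
        gcongr
        exact sqrt_pi_div_le n
    _ = K * (D₅ + D₃) * 3 * (√(5 * Real.pi / n) * (5 / √n ^ 2) / √n) := by
        field_simp
        ring
    _ = _ := by rw [hr2]

end MultiEdgeTree

namespace MultiEdgeTree

/-! ### The probability of a given height -/

/-- The number of trees with `n` edges and height `h`, in the normalization of its integral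
representation. -/
noncomputable def scaledCount (n h : ℕ) : ℝ :=
  2 * Real.pi * ({T : MultiEdgeTree | T.size = n ∧ T.height = h}.ncard : ℝ) / 5 ^ (n - 1)

/-- The number of trees with `n` edges, in the normalization of its integral representation. -/
noncomputable def scaledTotal (n : ℕ) : ℝ :=
  2 * Real.pi * ({T : MultiEdgeTree | T.size = n}.ncard : ℝ) / 5 ^ (n - 1)

theorem exists_abs_scaledCount_sub_le : ∃ D : ℝ, 0 < D ∧ ∀ n h : ℕ, 2 ≤ n → 1 ≤ h →
    |scaledCount n h - √(5 * Real.pi / n) * (25 * h / n ^ 2) * limitG (scaledHeight n h)| ≤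
      D * (√(5 * Real.pi / n) * (25 * h / n ^ 2) * ∑' m, termError n (scaledHeight n h) m) := by
  obtain ⟨D, hD, hle⟩ := exists_norm_coeff_termPoly_sub_le
  obtain ⟨C, hC, hCs⟩ := exists_tsum_termError_le_small
  refine ⟨D, hD, fun n h hn hh => ?_⟩
  have hn1 : 1 ≤ n := by omega
  have hα := scaledHeight_pos hn1 hh
  set α := scaledHeight n h
  set L : ℝ := √(5 * Real.pi / n)
  set a : ℕ+ → ℂ := fun m => 2 * Real.pi * (termPoly n h m).coeff (n + 1) / 5 ^ (n - 1)
  have hzero : ∀ m : ℕ, m ∉ Finset.range (n + 1) → (termPoly n h (m + 1)).coeff (n + 1) = 0 := by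
    intro m hm
    have hm' : n + 1 ≤ m := by simpa using hm
    exact coeff_termPoly_eq_zero (by nlinarith)
  have hsum : HasSum a (scaledCount n h : ℂ) := by
    have h1 : HasSum (fun m : ℕ => 2 * (Real.pi : ℂ) * (termPoly n h (m + 1)).coeff (n + 1) /
        5 ^ (n - 1)) (scaledCount n h : ℂ) := by
      have e : (scaledCount n h : ℂ) = ∑ m ∈ Finset.range (n + 1),
          2 * (Real.pi : ℂ) * (termPoly n h (m + 1)).coeff (n + 1) / 5 ^ (n - 1) := by
        rw [← Finset.sum_div, ← Finset.mul_sum, ← ncard_eq_sum_coeff hn1 hh, scaledCount]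
        push_cast
        rfl
      rw [e]
      exact hasSum_sum_of_ne_finset_zero fun m hm => by rw [hzero m hm, mul_zero, zero_div]
    rw [← Equiv.pnatEquivNat.symm.hasSum_iff]
    exact h1
  have hG : HasSum (fun m : ℕ+ => ((L * (25 * h / n ^ 2) * limitTerm α m : ℝ) : ℂ))
      ((L * (25 * h / n ^ 2) * limitG α : ℝ) : ℂ) :=
    Complex.hasSum_ofReal.2 ((summable_limitG hα).hasSum.mul_left _)
  have hE := ((hCs n α hn1 hα).1.hasSum.mul_left (L * (h / n ^ 2))).mul_left D
  have key := (hsum.sub hG).norm_le_of_bounded hE fun m => hle n h m hn hh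
  rw [← Complex.ofReal_sub, Complex.norm_real, Real.norm_eq_abs] at key
  refine key.trans ?_
  have hS : 0 ≤ ∑' m, termError n α m := tsum_nonneg fun m => termError_nonneg n hα m
  gcongr
  exact le_mul_of_one_le_left (Nat.cast_nonneg h) (by norm_num)

theorem scaledTotal_pos (n : ℕ) : 0 < scaledTotal n := by
  have h : 0 < {T : MultiEdgeTree | T.size = n}.ncard :=
    (Set.ncard_pos (finite_size_eq n)).2 (nonempty_size_eq n)
  have h' : (0 : ℝ) < ({T : MultiEdgeTree | T.size = n}.ncard : ℝ) := by exact_mod_cast h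
  unfold scaledTotal
  positivity

/-- The number of all trees up to a relative error `O(n ^ (-1/2))`, together with a lower bound
valid for all `n`. -/
theorem exists_scaledTotal_eq : ∃ D c : ℝ, 0 < D ∧ 0 < c ∧ ∀ n : ℕ, 2 ≤ n → ∃ e : ℝ,
    scaledTotal n = √(5 * Real.pi / n) * (5 / n) * (1 + e) ∧ |e| ≤ D / √n ∧ c ≤ 1 + e := by
  obtain ⟨D, hD, hle⟩ := exists_norm_coeff_totalPoly_sub_le
  have hL : ∀ n : ℕ, 2 ≤ n → 0 < √(5 * Real.pi / n) * (5 / n) := by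
    intro n hn
    have : (0 : ℝ) < n := by
      have : 0 < n := by omega
      exact_mod_cast this
    have := Real.pi_pos
    positivity
  set q : ℕ → ℝ := fun n => scaledTotal n / (√(5 * Real.pi / n) * (5 / n)) with hq
  have hq0 : ∀ n, 2 ≤ n → 0 < q n := fun n hn => div_pos (scaledTotal_pos n) (hL n hn)
  have hq1 : ∀ n, 2 ≤ n → |q n - 1| ≤ D / √n := by
    intro n hn
    have h1 := hle n hn
    have e : (2 * Real.pi * (totalPoly n).coeff n / 5 ^ (n - 1) : ℂ) = (scaledTotal n : ℝ) := by
      rw [← ncard_eq_coeff_totalPoly (by omega), scaledTotal]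
      push_cast
      rfl
    rw [e, ← Complex.ofReal_sub, Complex.norm_real, Real.norm_eq_abs] at h1
    have h2 : q n - 1 = (scaledTotal n - √(5 * Real.pi / n) * (5 / n)) /
        (√(5 * Real.pi / n) * (5 / n)) := by
      rw [sub_div, div_self (hL n hn).ne']
    rw [h2, abs_div, abs_of_pos (hL n hn), div_le_iff₀ (hL n hn)]
    exact h1.trans_eq (by ring)
  obtain ⟨n₀, hn₀⟩ := exists_nat_ge ((2 * D) ^ 2)
  have hbig : ∀ n, 2 ≤ n → n₀ ≤ n → 1 / 2 ≤ q n := by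
    intro n hn hn'
    have h0 : (0 : ℝ) < n := by
      have : 0 < n := by omega
      exact_mod_cast this
    have h1 : 2 * D ≤ √n := by
      refine Real.le_sqrt_of_sq_le (hn₀.trans ?_)
      exact_mod_cast hn'
    have h2 : D / √n ≤ 1 / 2 := by
      rw [div_le_div_iff₀ (Real.sqrt_pos.2 h0) (by norm_num)]
      linarith
    have := (abs_le.1 ((hq1 n hn).trans h2)).1
    linarith
  -- Below `n₀` only finitely many positive ratios have to be bounded from below.
  have hsmall : ∀ N : ℕ, ∃ c : ℝ, 0 < c ∧ ∀ n, 2 ≤ n → n < N → c ≤ q n := by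
    intro N
    induction N with
    | zero => exact ⟨1, one_pos, fun n _ h => absurd h (Nat.not_lt_zero n)⟩
    | succ N ih =>
      obtain ⟨c, hc, hcb⟩ := ih
      by_cases hN : 2 ≤ N
      · refine ⟨min c (q N), lt_min hc (hq0 N hN), fun n hn hlt => ?_⟩
        rcases Nat.lt_succ_iff_lt_or_eq.1 hlt with h | rfl
        · exact (min_le_left _ _).trans (hcb n hn h)
        · exact min_le_right _ _
      · exact ⟨c, hc, fun n hn hlt => absurd hn (by omega)⟩
  obtain ⟨c, hc, hcb⟩ := hsmall n₀
  refine ⟨D, min c (1 / 2), hD, lt_min hc (by norm_num), fun n hn => ⟨q n - 1, ?_, hq1 n hn, ?_⟩⟩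
  · rw [add_sub_cancel, hq]
    exact (mul_div_cancel₀ _ (hL n hn).ne').symm
  · rw [add_sub_cancel]
    rcases lt_or_ge n n₀ with h | h
    · exact (min_le_left _ _).trans (hcb n hn h)
    · exact (min_le_right _ _).trans (hbig n hn h)

theorem heightProb_eq_scaledCount_div (n h : ℕ) :
    heightProb n h = scaledCount n h / scaledTotal n := by
  have := Real.pi_pos
  rw [heightProb, scaledCount, scaledTotal, div_div_div_cancel_right₀ (by positivity),
    mul_div_mul_left _ _ (by positivity)]

/-- The relative error of the asymptotic formula, in the normalization of the theorem. -/
noncomputable def relativeError (ε : ℝ) (n h : ℕ) : ℝ :=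
  (h : ℝ) / n + (h : ℝ) ^ 4 / (n : ℝ) ^ 3 + Real.log n / (n : ℝ) ^ (1 / 2 - 2 * ε)

theorem rpow_div_sqrt_le {ε δ : ℝ} (hδ : δ ≤ 2 * ε) {n : ℕ} (hn : 2 ≤ n) :
    (n : ℝ) ^ δ / √n ≤ (Real.log 2)⁻¹ * (Real.log n / (n : ℝ) ^ (1 / 2 - 2 * ε)) := by
  have hn2 : (2 : ℝ) ≤ n := by exact_mod_cast hn
  have hn0 : (0 : ℝ) < n := by linarith
  have hlog2 : 0 < Real.log 2 := Real.log_pos (by norm_num)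
  have hlog : Real.log 2 ≤ Real.log n := Real.log_le_log (by norm_num) hn2
  have h1 : (n : ℝ) ^ δ / √n ≤ 1 / (n : ℝ) ^ (1 / 2 - 2 * ε) := by
    rw [Real.sqrt_eq_rpow, ← Real.rpow_sub hn0, one_div ((n : ℝ) ^ _), ← Real.rpow_neg hn0.le]
    exact Real.rpow_le_rpow_of_exponent_le (by linarith) (by linarith)
  refine h1.trans ?_
  rw [← mul_div_assoc]
  gcongr
  rw [inv_mul_eq_div, le_div_iff₀ hlog2]
  linarith

/-- For `α² ≥ 3` the relative error is `O(α⁴ / n + α / √n)`, that is `O(h⁴ / n³ + h / n)`. For `α² ≤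
3` it is `O(α² exp (π² / α²) / √n)`, where the lower bound on `h` enters. -/
theorem exists_tsum_termError_div_limitG_le {ε : ℝ} (hε : 0 < ε) : ∃ D : ℝ, 0 < D ∧
    ∀ n h : ℕ, 2 ≤ n → 1 ≤ h →
      Real.sqrt (4 * (n : ℝ) * Real.pi ^ 2 / (5 * ε * Real.log (n : ℝ))) < (h : ℝ) →
      (∑' m, termError n (scaledHeight n h) m) / limitG (scaledHeight n h) ≤
        D * relativeError ε n h := by
  obtain ⟨C₁, hC₁, hs⟩ := exists_tsum_termError_le_small
  obtain ⟨C₂, hC₂, hl⟩ := exists_tsum_termError_le_large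
  have hlog2 : 0 < Real.log 2 := Real.log_pos (by norm_num)
  refine ⟨3 * C₁ * (Real.log 2)⁻¹ + 2 * C₂, by positivity, fun n h hn hh hlow => ?_⟩
  have hn1 : 1 ≤ n := by omega
  have hn2 : (2 : ℝ) ≤ n := by exact_mod_cast hn
  have hn0 : (0 : ℝ) < n := by linarith
  have hh0 : (0 : ℝ) < h := by exact_mod_cast hh
  have hr : 0 < √(n : ℝ) := Real.sqrt_pos.2 hn0
  have hr2 : √(n : ℝ) ^ 2 = n := Real.sq_sqrt hn0.le
  have hlogn : 0 < Real.log n := Real.log_pos (by linarith)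
  have hα := scaledHeight_pos hn1 hh
  have hα2 := scaledHeight_sq n h
  have hG := limitG_pos hα
  have hR1 : 0 ≤ (h : ℝ) / n := by positivity
  have hR2 : 0 ≤ (h : ℝ) ^ 4 / (n : ℝ) ^ 3 := by positivity
  have hR3 : 0 ≤ Real.log n / (n : ℝ) ^ (1 / 2 - 2 * ε) := by positivity
  rw [div_le_iff₀ hG]
  set α := scaledHeight n h with hαdef
  rcases le_total (α ^ 2) 3 with h3 | h3
  · have hpi : Real.pi ^ 2 / α ^ 2 ≤ ε * Real.log n := by
      have h1 := Real.lt_sq_of_sqrt_lt hlow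
      rw [div_lt_iff₀ (by positivity)] at h1
      rw [hα2, div_div_eq_mul_div, div_le_iff₀ (by positivity)]
      linarith
    have hexp : Real.exp (Real.pi ^ 2 / α ^ 2) ≤ (n : ℝ) ^ ε := by
      rw [Real.rpow_def_of_pos hn0, mul_comm (Real.log n)]
      exact Real.exp_le_exp.2 hpi
    have hlowG := le_limitG_of_le_three hα h3
    have hup := (hs n α hn1 hα).2
    have hmid : C₁ / (α ^ 5 * √n) ≤ 3 * C₁ * ((n : ℝ) ^ ε / √n) *
        (Real.exp (-(Real.pi ^ 2 / α ^ 2)) / α ^ 7) := by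
      calc C₁ / (α ^ 5 * √n) = C₁ * α ^ 2 * (Real.exp (Real.pi ^ 2 / α ^ 2) / √n) *
            (Real.exp (-(Real.pi ^ 2 / α ^ 2)) / α ^ 7) := by
            rw [Real.exp_neg]
            field_simp
        _ ≤ C₁ * 3 * ((n : ℝ) ^ ε / √n) * (Real.exp (-(Real.pi ^ 2 / α ^ 2)) / α ^ 7) := by
            gcongr
        _ = _ := by ring
    have hx := rpow_div_sqrt_le (ε := ε) (δ := ε) (by linarith) hn
    calc _ ≤ 3 * C₁ * ((n : ℝ) ^ ε / √n) * (Real.exp (-(Real.pi ^ 2 / α ^ 2)) / α ^ 7) :=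
          hup.trans hmid
      _ ≤ 3 * C₁ * ((Real.log 2)⁻¹ * (Real.log n / (n : ℝ) ^ (1 / 2 - 2 * ε))) * limitG α := by
          gcongr
      _ ≤ _ := by
          refine mul_le_mul_of_nonneg_right ?_ hG.le
          have h4 : 0 ≤ (3 * C₁ * (Real.log 2)⁻¹) * ((h : ℝ) / n + (h : ℝ) ^ 4 / (n : ℝ) ^ 3) +
            2 * C₂ * relativeError ε n h := by
            rw [relativeError]
            positivity
          rw [relativeError] at h4 ⊢
          linarith
  · have hα1 : 1 ≤ α := by nlinarith
    have hlowG := le_limitG_of_three_le hα h3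
    have hup := hl n α hn1 hα1
    have h5 : √(5 : ℝ) ≤ 3 := sqrt_five_le
    have e1 : α ^ 4 / n = 25 / 16 * ((h : ℝ) ^ 4 / (n : ℝ) ^ 3) := by
      rw [show α ^ 4 = (α ^ 2) ^ 2 by ring, hα2]
      field_simp
      norm_num
    have e2 : α / √n = √5 / 2 * ((h : ℝ) / n) := by
      rw [hαdef, scaledHeight, div_div, mul_assoc, ← sq, hr2]
      ring
    calc _ ≤ C₂ * Real.exp (-α ^ 2) * (α ^ 6 / n + α ^ 3 / √n) := hup
      _ = C₂ * (α ^ 4 / n + α / √n) * (α ^ 2 * Real.exp (-α ^ 2)) := by ring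
      _ ≤ C₂ * (α ^ 4 / n + α / √n) * limitG α := by gcongr
      _ ≤ _ := by
          rw [e1, e2]
          refine mul_le_mul_of_nonneg_right ?_ hG.le
          have h6 : √5 / 2 * ((h : ℝ) / n) ≤ 2 * ((h : ℝ) / n) := by
            gcongr
            linarith
          have h7 : C₂ * (25 / 16 * ((h : ℝ) ^ 4 / (n : ℝ) ^ 3) + √5 / 2 * ((h : ℝ) / n)) ≤
              C₂ * (2 * relativeError ε n h) := by
            gcongr
            rw [relativeError]
            linarith
          have h8 : 0 ≤ 3 * C₁ * (Real.log 2)⁻¹ * relativeError ε n h := by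
            rw [relativeError]
            positivity
          linarith

theorem exists_heightProb_eq {ε : ℝ} (hε : 0 < ε) : ∃ C : ℝ, 0 < C ∧ ∀ n h : ℕ, 2 ≤ n →
    Real.sqrt (4 * (n : ℝ) * Real.pi ^ 2 / (5 * ε * Real.log (n : ℝ))) < (h : ℝ) →
    ∃ δ : ℝ, |δ| ≤ C * relativeError ε n h ∧
      heightProb n h = 5 * (h : ℝ) / n * limitG (scaledHeight n h) * (1 + δ) := by
  obtain ⟨D₁, hD₁, h₁⟩ := exists_abs_scaledCount_sub_le
  obtain ⟨D₂, c, hD₂, hc, h₂⟩ := exists_scaledTotal_eq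
  obtain ⟨D₃, hD₃, h₃⟩ := exists_tsum_termError_div_limitG_le hε
  have hlog2 : 0 < Real.log 2 := Real.log_pos (by norm_num)
  refine ⟨(D₁ * D₃ + D₂ * (Real.log 2)⁻¹) / c, by positivity, fun n h hn hlow => ?_⟩
  have hn1 : 1 ≤ n := by omega
  have hn2 : (2 : ℝ) ≤ n := by exact_mod_cast hn
  have hn0 : (0 : ℝ) < n := by linarith
  have hh0 : (0 : ℝ) < h := (Real.sqrt_nonneg _).trans_lt hlow
  have hh : 1 ≤ h := by
    have : 0 < h := by exact_mod_cast hh0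
    omega
  have hG := limitG_pos (scaledHeight_pos hn1 hh)
  have hα := scaledHeight_pos hn1 hh
  have hcount := h₁ n h hn hh
  have hratio := h₃ n h hn hh hlow
  obtain ⟨e, he, heD, hec⟩ := h₂ n hn
  set α := scaledHeight n h
  set G := limitG α
  set S := ∑' m, termError n α m
  have hS : 0 ≤ S := tsum_nonneg fun m => termError_nonneg n hα m
  have hLpos : 0 < √(5 * Real.pi / n) := Real.sqrt_pos.2 (by have := Real.pi_pos; positivity)
  set L := √(5 * Real.pi / n)
  have hF : 0 < L * (25 * h / n ^ 2) := by positivity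
  set F := L * (25 * h / n ^ 2) with hFdef
  have h1e : 0 < 1 + e := hc.trans_le hec
  -- `E` is the absolute error of the count, in the units in which the main term is `G`.
  set E := scaledCount n h / F - G with hE
  have hcnt : scaledCount n h = F * (G + E) := by
    rw [hE, add_sub_cancel, mul_div_cancel₀ _ hF.ne']
  have hEb : |E| ≤ D₁ * S := by
    have e1 : scaledCount n h - F * G = F * E := by
      rw [hcnt]
      ring
    rw [e1, abs_mul, abs_of_pos hF] at hcount
    refine le_of_mul_le_mul_left ?_ hF
    linarith
  refine ⟨(E / G - e) / (1 + e), ?_, ?_⟩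
  · rw [abs_div, abs_of_pos h1e]
    have hb1 : |E / G| ≤ D₁ * D₃ * relativeError ε n h := by
      rw [abs_div, abs_of_pos hG]
      calc |E| / G ≤ D₁ * S / G := by gcongr
        _ = D₁ * (S / G) := by ring
        _ ≤ D₁ * (D₃ * relativeError ε n h) := by gcongr
        _ = _ := by ring
    have hb2 : |e| ≤ D₂ * (Real.log 2)⁻¹ * relativeError ε n h := by
      have hx := rpow_div_sqrt_le (ε := ε) (δ := 0) (by linarith) hn
      rw [Real.rpow_zero] at hx
      have hle : Real.log n / (n : ℝ) ^ (1 / 2 - 2 * ε) ≤ relativeError ε n h := by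
        rw [relativeError]
        exact le_add_of_nonneg_left (by positivity)
      calc |e| ≤ D₂ * (1 / √n) := heD.trans_eq (by ring)
        _ ≤ D₂ * ((Real.log 2)⁻¹ * (Real.log n / (n : ℝ) ^ (1 / 2 - 2 * ε))) := by gcongr
        _ ≤ D₂ * ((Real.log 2)⁻¹ * relativeError ε n h) := by gcongr
        _ = _ := by ring
    calc |E / G - e| / (1 + e) ≤ (D₁ * D₃ * relativeError ε n h +
          D₂ * (Real.log 2)⁻¹ * relativeError ε n h) / c := by
          refine div_le_div₀ (by linarith [abs_nonneg (E / G), abs_nonneg e])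
            ((abs_sub _ _).trans (add_le_add hb1 hb2)) hc hec
      _ = _ := by ring
  · rw [heightProb_eq_scaledCount_div, hcnt, he, hFdef]
    field_simp
    ring

end MultiEdgeTree

theorem mainTheorem2 :
    (∀ ε : ℝ, 0 < ε → ε < 1 / 6 →
      ∃ C : ℝ, 0 < C ∧ ∀ n h : ℕ, 2 ≤ n →
        Real.sqrt (4 * (n : ℝ) * Real.pi ^ 2 / (5 * ε * Real.log (n : ℝ))) < (h : ℝ) →
        (h : ℝ) < (n : ℝ) ^ (3 / 4 - ε) →
        ∃ δ : ℝ,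
          |δ| ≤ C * ((h : ℝ) / (n : ℝ) + (h : ℝ) ^ 4 / (n : ℝ) ^ 3
              + Real.log (n : ℝ) / (n : ℝ) ^ (1 / 2 - 2 * ε)) ∧
          MultiEdgeTree.heightProb n h =
            5 * (h : ℝ) / (n : ℝ)
              * MultiEdgeTree.limitG (Real.sqrt 5 * (h : ℝ) / (2 * Real.sqrt (n : ℝ)))
              * (1 + δ)) ∧
    (∀ α : ℝ, 0 < α →
      Summable (fun m : ℕ+ =>
        (2 * α ^ 2 * (m : ℝ) ^ 2 - 3) * (m : ℝ) ^ 2 * Real.exp (-α ^ 2 * (m : ℝ) ^ 2)) ∧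
      Summable (fun m : ℕ+ =>
        (2 * (Real.pi / α) ^ 2 * (m : ℝ) ^ 2 - 3) * (m : ℝ) ^ 2
          * Real.exp (-(Real.pi / α) ^ 2 * (m : ℝ) ^ 2)) ∧
      MultiEdgeTree.limitG α =
        Real.sqrt (Real.pi ^ 5) / α ^ 5 *
          ∑' m : ℕ+, (2 * (Real.pi / α) ^ 2 * (m : ℝ) ^ 2 - 3) * (m : ℝ) ^ 2
            * Real.exp (-(Real.pi / α) ^ 2 * (m : ℝ) ^ 2)) := by
  refine ⟨fun ε hε _ => ?_, fun α hα => ⟨MultiEdgeTree.summable_limitG hα,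
    MultiEdgeTree.summable_limitG (div_pos Real.pi_pos hα), MultiEdgeTree.limitG_dual hα⟩⟩
  obtain ⟨C, hC, hmain⟩ := MultiEdgeTree.exists_heightProb_eq hε
  exact ⟨C, hC, fun n h hn hlow _ => hmain n h hn hlow⟩
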